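/- Let $\mathbb D=\{z\in\mathbb C:|z|<1\}$ and $\mathbb T=\partial\mathbb D$. For $h:\mathbb D\to\mathbb C$ put $\|h\|_\infty=\sup_{z\in\mathbb D}|h(z)|\in[0,\infty]$, and for $\psi\in L^1(\mathbb T)$ let $$\mathcal P_\psi(z)=\frac1{2\pi}\int_0^{2\pi}\frac{1-|z|^2}{|1-ze^{-it}|^2}\,\psi(e^{it})\,dt\qquad(z\in\mathbb D).$$ For $f:\mathbb D\to\mathbb C$ let $D_f(z)$ be the real derivative of $f$ at $z$ and $\|D_f(z)\|=\sup_{|\xi|=1}|D_f(z)\xi|=|f_z(z)|+|f_{\bar z}(z)|$. Let $g\in\mathcal C(\overline{\mathbb D})$ and let $f\in\mathcal C^2(\mathbb D)$ satisfy $\Delta f=g$ in $\mathbb D$ and $f|_{\mathbb T}=\psi\in L^1(\mathbb T)$, in the sense that $\int_0^{2\pi}|f(re^{it})-\psi(e^{it})|\,dt\to0$ as $r\to1^-$. For $0<r<1$ let $$\mu(r)=\frac{\|g\|_\infty(1-r^2)}{8r^2}\left[\frac{1+r^2}{1-r^2}-\frac{1-r^2}{2r}\log\frac{1+r}{1-r}\right].$$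 Then $\|g\|_\infty<\infty$ and the following hold (the bounds involving $\|\mathcal P_\psi\|_\infty$ being understood in $[0,\infty]$). (a) For every $z\in\mathbb D\setminus\{0\}$, $$\|D_f(z)\|\le\frac{4\|\mathcal P_\psi\|_\infty}{\pi}\frac1{1-|z|^2}+2\mu(|z|).$$ (b) $\frac{\|g\|_\infty}4\le\mu(r)\le\frac{\|g\|_\infty}3$ for $0<r<1$, and $\mu$ is decreasing on $(0,1)$ (strictly decreasing if $\|g\|_\infty>0$). (c) At the origin, $$\|D_f(0)\|\le\lim_{z\to0,\,z\ne0}\left(\frac{4\|\mathcal P_\psi\|_\infty}{\pi}\frac1{1-|z|^2}+2\mu(|z|)\right)=\frac4\pi\|\mathcal P_\psi\|_\infty+\frac23\|g\|_\infty.$$ (d) Both estimates are sharp when $g=0$. Let $M>0$, $|\alpha|=1$, let $\phi$ be a conformal automorphism of $\mathbb D$, and let $$f(z)=\frac{2M\alpha}{\pi}\arg\left(\frac{1+\phi(z)}{1-\phi(z)}\right),$$ with the principal value of the argument. Then $f$ satisfies the hypotheses with $g=0$ and some $\psi\in L^1(\mathbb T)$ for which $\|\mathcal P_\psi\|_\infty=M$,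 and equality holds in (a) at every $z\in\mathbb D\setminus\{0\}$ for which $\phi(z)$ is real, and in (c) if $\phi(0)$ is real. Moreover, for every $z\in\mathbb D$ there is a conformal automorphism $\phi$ of $\mathbb D$ with $\phi(z)=0$; so equality occurs at every point of $\mathbb D$, for every $M>0$. -/

import Mathlib

open Set Filter Topology Metric
open scoped ENNReal

noncomputable section

/-- The Poisson integral
`P_ψ(z) = (1 / 2π) ∫₀^{2π} (1 - |z|²) / |e^{it} - z|² · ψ(e^{it}) dt`
of a function `ψ` on the unit circle. -/
def poissonIntegral (ψ : ℂ → ℂ) (z : ℂ) : ℂ :=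
  Real.circleAverage (fun ζ => poissonKernel 0 z ζ • ψ ζ) 0 1

/-- `‖h‖_∞ = sup_{|z| < 1} |h(z)|`, as an element of `[0, ∞]`. -/
def discSup (h : ℂ → ℂ) : ℝ≥0∞ :=
  ⨆ z ∈ ball (0 : ℂ) 1, ‖h z‖ₑ

/-- `f` is a `C²` solution in the open unit disc of the Poisson equation `Δ f = g`, where `g` is
continuous on the closed unit disc, and `f` has the boundary values `ψ ∈ L¹(𝕋)`:
the functions `f_r(ζ) = f(rζ)` converge to `ψ` in `L¹(𝕋)` as `r → 1⁻`. -/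
structure IsPoissonSolution (f g ψ : ℂ → ℂ) : Prop where
  continuousOn_rhs : ContinuousOn g (closedBall 0 1)
  contDiffOn : ContDiffOn ℝ 2 f (ball 0 1)
  laplacian_eq : ∀ z ∈ ball (0 : ℂ) 1, Laplacian.laplacian f z = g z
  integrable_boundary : CircleIntegrable ψ 0 1
  tendsto_boundary :
    Tendsto (fun r : ℝ => ∫ t in (0 : ℝ)..(2 * Real.pi),
      ‖f (circleMap 0 r t) - ψ (circleMap 0 1 t)‖) (𝓝[<] 1) (𝓝 0)

/-- The function
`μ(r) = N (1 - r²) / (8 r²) · [(1 + r²) / (1 - r²) - (1 - r²) / (2 r) · log ((1 + r) / (1 - r))]`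
for `0 < r < 1`, where `N` stands for `‖g‖_∞`. -/
def muFun (N r : ℝ) : ℝ :=
  N * (1 - r ^ 2) / (8 * r ^ 2) *
    ((1 + r ^ 2) / (1 - r ^ 2) - (1 - r ^ 2) / (2 * r) * Real.log ((1 + r) / (1 - r)))

/-- The bound `(4 P / π) / (1 - r²) + 2 μ(r)` for `0 < r < 1`, in `[0, ∞]`; here `P` stands for
`‖P_ψ‖_∞`, which may be infinite, and `N` for `‖g‖_∞`. -/
def gradBound (P : ℝ≥0∞) (N r : ℝ) : ℝ≥0∞ :=
  ENNReal.ofReal (4 / Real.pi * (1 / (1 - r ^ 2))) * P + ENNReal.ofReal (2 * muFun N r)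

/-- The bound `(4 / π) P + (2 / 3) N` at the origin, in `[0, ∞]`. -/
def gradBoundZero (P : ℝ≥0∞) (N : ℝ) : ℝ≥0∞ :=
  ENNReal.ofReal (4 / Real.pi) * P + ENNReal.ofReal (2 / 3 * N)

/-- `φ` restricts to a conformal automorphism of the open unit disc: a holomorphic map of the disc
to itself with a holomorphic inverse. -/
def IsDiscAutomorphism (φ : ℂ → ℂ) : Prop :=
  DifferentiableOn ℂ φ (ball 0 1) ∧ MapsTo φ (ball 0 1) (ball 0 1) ∧
    ∃ χ : ℂ → ℂ, DifferentiableOn ℂ χ (ball 0 1) ∧ MapsTo χ (ball 0 1) (ball 0 1) ∧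
      InvOn χ φ (ball 0 1) (ball 0 1)

/-- The extremal function `f(z) = (2 M α / π) arg ((1 + φ(z)) / (1 - φ(z)))`. -/
def extremalFun (M : ℝ) (α : ℂ) (φ : ℂ → ℂ) (z : ℂ) : ℂ :=
  2 * (M : ℂ) * α / (Real.pi : ℂ) * (Complex.arg ((1 + φ z) / (1 - φ z)) : ℂ)

end

/-! The derivative of a function at the centre of a disc is carried by its first Fourier mode on
circles. With q(t) = 2 Re(conj ξ e^{it}), the integral A(x) of q(t) F(x e^{it}) satisfies A'' + A'/x
- A/x² = ∫ q ΔF. Solving this radial equation gives A(1) - 2π DF(0)ξ = ∫₀¹ (1 - x²)/2 ∫ q ΔF dt dx.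
Since |q| ≤ 2, this yields the estimate `norm_firstMode_sub_fderiv_le`.

A Möbius map sending 0 to z transports the estimate to z. The Laplacian picks up the factor |φ'|² =
(1 - |z|²)² / |1 + conj z ζ|⁴, whose circle means are explicit (`integral_one_div_norm_pow_four`);
the remaining integral in x is elementary and equals the stated μ up to a factor
(`greenPrimitive_one`). On the boundary side, q becomes the kernel `gradKernel`, whose L¹ norm is 8
/ (1 - |z|²); dividing by 2π produces the constant 4/π. This is
`norm_integral_gradKernel_sub_fderiv_le`, for functions smooth past the closed disc.

A general solution f is reached through its dilations f(R·) as R → 1, the L¹ boundary convergence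
handling the circle integral. To have ‖P_ψ‖_∞ in the bound, the kernel is also dilated: Poisson
integration is symmetric on the circle, so the dilation passes from the kernel to ψ
(`norm_integral_gradKernel_smul_le`). The bound at the origin follows by continuity of Df.

All properties of μ are read off from 1/3 - μ(r) = Σ r^{2k+2} / ((2k+1)(2k+3)(2k+5)) for N = 1
(`hasSum_muFun`), whose coefficients are positive with sum 1/12.

For sharpness, the Schwarz lemma puts every automorphism in the form c · (Möbius map). Then (1 +
φ)/(1 - φ) maps the disc into the right half plane, so its argument is harmonic with supremum π/2,
and at points where φ is real the derivative is computed from |φ'| / (1 - |φ|²) = 1 / (1 - |z|²). -/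

/-! ### The function μ through its power series -/

/-- The coefficients of the power series of `1 / 3 - μ` (for `N = 1`). -/
noncomputable def muCoeff (k : ℕ) : ℝ := 1 / ((2 * k + 1) * (2 * k + 3) * (2 * k + 5))

lemma muCoeff_pos (k : ℕ) : 0 < muCoeff k := by
  unfold muCoeff; positivity

lemma hasSum_muCoeff : HasSum muCoeff (1 / 12) := by
  have hlim : Tendsto (fun n : ℕ => (1 / 4 : ℝ) * (1 / ((2 * n + 1) * (2 * n + 3)))) atTop (𝓝 0) := by
    have h1 : Tendsto (fun n : ℕ => (1 : ℝ) / (n + 1)) atTop (𝓝 0) :=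
      tendsto_one_div_add_atTop_nhds_zero_nat
    refine squeeze_zero (fun n => by positivity) (fun n => ?_) h1
    rw [one_div_mul_one_div, one_div_le_one_div (by positivity) (by positivity)]
    have : (0 : ℝ) ≤ n := n.cast_nonneg
    nlinarith
  rw [hasSum_iff_tendsto_nat_of_nonneg (fun k => (muCoeff_pos k).le)]
  -- The series telescopes, with remainder 1 / (4 (2n+1)(2n+3)).
  have hs : ∀ n : ℕ, ∑ k ∈ Finset.range n, muCoeff k
      = 1 / 12 - (1 / 4 : ℝ) * (1 / ((2 * n + 1) * (2 * n + 3))) := by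
    intro n
    induction n with
    | zero => norm_num
    | succ n ih =>
      rw [Finset.sum_range_succ, ih, muCoeff]
      push_cast
      field_simp
      ring
  simp_rw [hs]
  simpa using hlim.const_sub (1 / 12 : ℝ)

/-- By partial fractions, 8 `muCoeff k` = 1/(2k+1) - 2/(2k+3) + 1/(2k+5), so the series combines
three shifts of the series of log((1+r)/(1-r)) / (2r). -/
lemma hasSum_muFun {r : ℝ} (h0 : 0 < r) (h1 : r < 1) :
    HasSum (fun k => muCoeff k * r ^ (2 * k + 2)) (1 / 3 - muFun 1 r) := by
  have hr : |r| < 1 := by rwa [abs_of_pos h0]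
  set S : ℝ := Real.log ((1 + r) / (1 - r)) / (2 * r) with hS
  have hL : HasSum (fun k : ℕ => r ^ (2 * k) / (2 * k + 1)) S := by
    have := (Real.hasSum_log_sub_log_of_abs_lt_one hr).div_const (2 * r)
    rw [← Real.log_div (by linarith) (by linarith), ← hS] at this
    refine this.congr_fun fun k => ?_
    field_simp
    ring
  have hL1 : HasSum (fun k : ℕ => r ^ (2 * k + 2) / (2 * k + 3)) (S - 1) := by
    have := (hasSum_nat_add_iff' 1).2 hL
    simp only [Finset.range_one, Finset.sum_singleton, mul_zero, pow_zero, CharP.cast_eq_zero,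
      zero_add, div_one] at this
    refine this.congr_fun fun k => ?_
    push_cast
    ring_nf
  have hL2 : HasSum (fun k : ℕ => r ^ (2 * k + 4) / (2 * k + 5)) (S - 1 - r ^ 2 / 3) := by
    have := (hasSum_nat_add_iff' 1).2 hL1
    simp only [Finset.range_one, Finset.sum_singleton, mul_zero, CharP.cast_eq_zero,
      zero_add] at this
    refine this.congr_fun fun k => ?_
    push_cast
    ring_nf
  have := (((hL.mul_left (r ^ 2)).sub (hL1.mul_left 2)).add (hL2.div_const (r ^ 2))).div_const 8
  have hv : (r ^ 2 * S - 2 * (S - 1) + (S - 1 - r ^ 2 / 3) / r ^ 2) / 8 = 1 / 3 - muFun 1 r := by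
    have hlog : Real.log ((1 + r) / (1 - r)) = S * (2 * r) := by rw [hS]; field_simp
    have h2 : 1 - r ^ 2 ≠ 0 := by nlinarith
    rw [muFun, hlog]
    field_simp
    ring
  rw [hv] at this
  refine this.congr_fun fun k => ?_
  rw [muCoeff]
  field_simp
  ring

lemma muFun_eq_mul (N r : ℝ) : muFun N r = N * muFun 1 r := by
  unfold muFun; ring

lemma muFun_one_le {r : ℝ} (hr : r ∈ Ioo (0 : ℝ) 1) : muFun 1 r ≤ 1 / 3 := by
  have := (hasSum_muFun hr.1 hr.2).nonneg
    (fun k => mul_nonneg (muCoeff_pos k).le (pow_nonneg hr.1.le _))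
  linarith

/-- Every power in the series is at most r², and the coefficients sum to 1/12. As r < 1, this
contains the lower bound 1/4; it also gives the limit at 0. -/
lemma le_muFun_one {r : ℝ} (hr : r ∈ Ioo (0 : ℝ) 1) : 1 / 3 - r ^ 2 / 12 ≤ muFun 1 r := by
  have := hasSum_le (fun k => ?_) (hasSum_muFun hr.1 hr.2) (hasSum_muCoeff.mul_right (r ^ 2))
  · linarith
  · have h1 : r ^ (2 * k + 2) ≤ r ^ 2 := pow_le_pow_of_le_one hr.1.le hr.2.le (by omega)
    exact mul_le_mul_of_nonneg_left h1 (muCoeff_pos k).le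

lemma strictAntiOn_muFun_one : StrictAntiOn (muFun 1) (Ioo 0 1) := by
  intro r hr s hs hrs
  have := hasSum_lt (i := 0) (fun k => ?_) ?_ (hasSum_muFun hr.1 hr.2) (hasSum_muFun hs.1 hs.2)
  · linarith
  · exact mul_le_mul_of_nonneg_left (pow_le_pow_left₀ hr.1.le hrs.le _) (muCoeff_pos k).le
  · exact mul_lt_mul_of_pos_left (pow_lt_pow_left₀ hrs hr.1.le (by norm_num)) (muCoeff_pos 0)

lemma tendsto_muFun (N : ℝ) : Tendsto (muFun N) (𝓝[>] 0) (𝓝 (N / 3)) := by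
  have h : Tendsto (muFun 1) (𝓝[>] 0) (𝓝 (1 / 3)) := by
    have h1 : Tendsto (fun r : ℝ => 1 / 3 - r ^ 2 / 12) (𝓝[>] 0) (𝓝 (1 / 3)) := by
      have : Continuous fun r : ℝ => 1 / 3 - r ^ 2 / 12 := by fun_prop
      simpa using (this.tendsto 0).mono_left nhdsWithin_le_nhds
    have hIoo : Ioo (0 : ℝ) 1 ∈ 𝓝[>] (0 : ℝ) := Ioo_mem_nhdsGT one_pos
    refine tendsto_of_tendsto_of_tendsto_of_le_of_le' h1 tendsto_const_nhds ?_ ?_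
    · filter_upwards [hIoo] with r hr using le_muFun_one hr
    · filter_upwards [hIoo] with r hr using muFun_one_le hr
  have := h.const_mul N
  rw [mul_one_div] at this
  exact this.congr fun r => (muFun_eq_mul N r).symm

lemma tendsto_gradBound (P : ℝ≥0∞) (N : ℝ) :
    Tendsto (fun z : ℂ => gradBound P N ‖z‖) (𝓝[≠] 0) (𝓝 (gradBoundZero P N)) := by
  have hn : Tendsto (fun z : ℂ => ‖z‖) (𝓝[≠] 0) (𝓝[>] 0) := tendsto_norm_nhdsNE_zero
  refine Tendsto.comp (g := gradBound P N) ?_ hn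
  unfold gradBound gradBoundZero
  -- The limiting coefficient 4/π is nonzero, so multiplication by `P` is continuous there even when
  -- `P = ∞`.
  refine Tendsto.add (ENNReal.Tendsto.mul_const ?_ (Or.inl ?_)) ?_
  · refine ENNReal.tendsto_ofReal ?_
    have : ContinuousAt (fun r : ℝ => 4 / Real.pi * (1 / (1 - r ^ 2))) 0 := by
      apply ContinuousAt.mul continuousAt_const
      apply ContinuousAt.div continuousAt_const (by fun_prop) (by norm_num)
    have h := this.tendsto.mono_left (nhdsWithin_le_nhds (s := Ioi 0))
    simpa using h
  · simpa using Real.pi_pos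
  · refine ENNReal.tendsto_ofReal ?_
    have := (tendsto_muFun N).const_mul 2
    convert this using 2
    ring

/-! ### The radial integral that produces μ -/

/-- An antiderivative, in `x`, of `(1 - x²) (1 + r² x²) / (1 - r² x²)³`. -/
noncomputable def greenPrimitive (r x : ℝ) : ℝ :=
  (1 - 1 / r ^ 2) / 2 * (x / (1 - r ^ 2 * x ^ 2) ^ 2)
    + (1 / r ^ 2 + (1 - 1 / r ^ 2) / 4) * (x / (1 - r ^ 2 * x ^ 2))
    + (1 - 1 / r ^ 2) / (8 * r) * (Real.log (1 + r * x) - Real.log (1 - r * x))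

lemma hasDerivAt_greenPrimitive {r x : ℝ} (h0 : 0 < r) (hx : |r * x| < 1) :
    HasDerivAt (greenPrimitive r)
      ((1 - x ^ 2) * (1 + r ^ 2 * x ^ 2) / (1 - r ^ 2 * x ^ 2) ^ 3) x := by
  obtain ⟨hx1, hx2⟩ := abs_lt.1 hx
  have hu : 1 - r ^ 2 * x ^ 2 ≠ 0 := by nlinarith
  have h1 : 1 + r * x ≠ 0 := by linarith
  have h2 : 1 - r * x ≠ 0 := by linarith
  have hU : HasDerivAt (fun x : ℝ => 1 - r ^ 2 * x ^ 2) (-(r ^ 2 * (2 * x))) x := by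
    simpa using ((hasDerivAt_pow 2 x).const_mul (r ^ 2)).const_sub 1
  have hA := ((hasDerivAt_id x).div (hU.pow 2) (pow_ne_zero 2 hu)).const_mul ((1 - 1 / r ^ 2) / 2)
  have hB := ((hasDerivAt_id x).div hU hu).const_mul (1 / r ^ 2 + (1 - 1 / r ^ 2) / 4)
  have hl1 : HasDerivAt (fun x : ℝ => 1 + r * x) r x := by
    simpa using ((hasDerivAt_id x).const_mul r).const_add 1
  have hl2 : HasDerivAt (fun x : ℝ => 1 - r * x) (-r) x := by
    simpa using ((hasDerivAt_id x).const_mul r).const_sub 1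
  have hC := ((hl1.log h1).sub (hl2.log h2)).const_mul ((1 - 1 / r ^ 2) / (8 * r))
  refine ((hA.add hB).add hC).congr_deriv ?_
  have hf : (r / (1 + r * x) - -r / (1 - r * x)) = 2 * r / (1 - r ^ 2 * x ^ 2) := by
    field_simp; ring
  rw [hf]
  simp only [id, Nat.cast_ofNat, Nat.add_one_sub_one, pow_one, Pi.pow_apply]
  field_simp
  ring

lemma greenPrimitive_zero (r : ℝ) : greenPrimitive r 0 = 0 := by
  simp [greenPrimitive]

lemma greenPrimitive_one {r : ℝ} (h0 : 0 < r) (h1 : r < 1) :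
    (1 - r ^ 2) ^ 2 * greenPrimitive r 1 = 2 * (1 - r ^ 2) * muFun 1 r := by
  have : 1 - r ^ 2 ≠ 0 := by nlinarith
  rw [greenPrimitive, muFun, mul_one, ← Real.log_div (by linarith) (by linarith)]
  field_simp
  ring

/-! ### First Fourier mode on circles -/

open MeasureTheory in
lemma hasDerivAt_intervalIntegral_of_continuousOn {H H' : ℝ → ℝ → ℂ} {U : Set ℝ} (hU : IsOpen U)
    (hH : ∀ x ∈ U, Continuous (H x)) (hd : ∀ x ∈ U, ∀ t, HasDerivAt (fun y => H y t) (H' x t) x)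
    (hc : ContinuousOn (fun p : ℝ × ℝ => H' p.1 p.2) (U ×ˢ univ)) {x : ℝ} (hx : x ∈ U) (a b : ℝ) :
    HasDerivAt (fun y => ∫ t in a..b, H y t) (∫ t in a..b, H' x t) x := by
  obtain ⟨δ, hδ, hball⟩ := nhds_basis_closedBall.mem_iff.1 (hU.mem_nhds hx)
  have hK : IsCompact (closedBall x δ ×ˢ uIcc a b) := (isCompact_closedBall x δ).prod isCompact_uIcc
  obtain ⟨C, hC⟩ := hK.exists_bound_of_continuousOn
    (hc.mono (prod_mono hball (subset_univ _)))
  have hH' : Continuous (H' x) := by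
    rw [← continuousOn_univ]
    exact ContinuousOn.comp (f := fun t : ℝ => (x, t)) hc (by fun_prop) (fun t _ => ⟨hx, mem_univ _⟩)
  refine (intervalIntegral.hasDerivAt_integral_of_dominated_loc_of_deriv_le
    (bound := fun _ => C) (closedBall_mem_nhds x hδ) ?_ ((hH x hx).intervalIntegrable _ _)
    hH'.aestronglyMeasurable ?_ intervalIntegrable_const ?_).2
  · filter_upwards [hU.mem_nhds hx] with y hy using (hH y hy).aestronglyMeasurable
  · exact Eventually.of_forall fun t ht y hy => hC (y, t) ⟨hy, uIoc_subset_uIcc ht⟩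
  · exact Eventually.of_forall fun t ht y hy => hd y (hball hy) t

/-- `2 Re (conj ξ * e^{it})`. -/
noncomputable def dirCos (ξ : ℂ) (t : ℝ) : ℝ := 2 * (ξ.re * Real.cos t + ξ.im * Real.sin t)

lemma dirCos_eq_re (ξ : ℂ) (t : ℝ) :
    dirCos ξ t = 2 * ((starRingEnd ℂ) ξ * circleMap 0 1 t).re := by
  simp [dirCos, circleMap, Complex.exp_re, Complex.exp_im]

lemma continuous_dirCos (ξ : ℂ) : Continuous (dirCos ξ) := by
  unfold dirCos; fun_prop

lemma abs_dirCos_le (ξ : ℂ) (t : ℝ) : |dirCos ξ t| ≤ 2 * ‖ξ‖ := by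
  rw [dirCos_eq_re, abs_mul, abs_two]
  gcongr
  refine (Complex.abs_re_le_norm _).trans ?_
  simp

lemma hasDerivAt_dirCos (ξ : ℂ) (t : ℝ) :
    HasDerivAt (dirCos ξ) (dirCos (-(Complex.I * ξ)) t) t := by
  have := (((Real.hasDerivAt_cos t).const_mul ξ.re).add
    ((Real.hasDerivAt_sin t).const_mul ξ.im)).const_mul 2
  refine this.congr_deriv ?_
  simp [dirCos]
  ring

lemma dirCos_neg (ξ : ℂ) (t : ℝ) : dirCos (-ξ) t = -dirCos ξ t := by
  simp [dirCos]; ring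

lemma dirCos_two_pi (ξ : ℂ) : dirCos ξ (2 * Real.pi) = dirCos ξ 0 := by
  simp [dirCos]

lemma circleMap_two_pi (R : ℝ) : circleMap 0 R (2 * Real.pi) = circleMap 0 R 0 := by
  simp [circleMap]

lemma integral_dirCos_smul_const (ξ c : ℂ) :
    ∫ t in (0 : ℝ)..2 * Real.pi, dirCos ξ t • c = 0 := by
  have h := intervalIntegral.integral_eq_sub_of_hasDerivAt (a := 0) (b := 2 * Real.pi)
    (f := fun t => dirCos (Complex.I * ξ) t • c) (f' := fun t => dirCos ξ t • c) (fun t _ => ?_)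
    (((continuous_dirCos ξ).smul continuous_const).intervalIntegrable _ _)
  · rw [h, dirCos_two_pi, sub_self]
  · have := (hasDerivAt_dirCos (Complex.I * ξ) t).smul_const c
    rwa [← mul_assoc, Complex.I_mul_I, neg_one_mul, neg_neg] at this

/-- On the unit circle 2 Re(conj ξ e) e = conj ξ e² + ξ, and the first term has mean zero. This is
how the first mode recovers the direction ξ. -/
lemma integral_dirCos_smul_circleMap (ξ : ℂ) :
    ∫ t in (0 : ℝ)..2 * Real.pi, dirCos ξ t • circleMap 0 1 t = (2 * Real.pi) • ξ := by
  have h := intervalIntegral.integral_eq_sub_of_hasDerivAt (a := 0) (b := 2 * Real.pi)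
    (f := fun t => (starRingEnd ℂ) ξ * circleMap 0 1 t ^ 2 / (2 * Complex.I) + t * ξ)
    (f' := fun t => dirCos ξ t • circleMap 0 1 t) (fun t _ => ?_)
    (((continuous_dirCos ξ).smul (continuous_circleMap 0 1)).intervalIntegrable _ _)
  · rw [h, circleMap_two_pi]
    simp
  · have h1 := ((((hasDerivAt_circleMap 0 1 t).pow 2).const_mul ((starRingEnd ℂ) ξ)).div_const
      (2 * Complex.I)).add ((Complex.ofRealCLM.hasDerivAt (x := t)).mul_const ξ)
    refine h1.congr_deriv ?_
    have hre : ((dirCos ξ t : ℝ) : ℂ) = (starRingEnd ℂ) ξ * circleMap 0 1 t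
        + ξ * (starRingEnd ℂ) (circleMap 0 1 t) := by
      have := Complex.add_conj ((starRingEnd ℂ) ξ * circleMap 0 1 t)
      rw [map_mul, Complex.conj_conj] at this
      rw [this, dirCos_eq_re]
    have hone : (starRingEnd ℂ) (circleMap 0 1 t) * circleMap 0 1 t = 1 := by
      rw [Complex.conj_mul', norm_circleMap_zero]; simp
    rw [Complex.real_smul, hre]
    simp only [Nat.cast_ofNat, Nat.add_one_sub_one, pow_one, Complex.ofRealCLM_apply,
      Complex.ofReal_one, one_mul]
    field_simp
    linear_combination -ξ * hone

/-- The trace of a bilinear form is the same in every orthonormal frame, here a and Ia scaled. The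
mixed terms cancel in pairs, so symmetry of `B` plays no role. It serves both the polar form of the
Laplacian and its conformal covariance. -/
lemma bilin_add_bilin_I_mul (B : ℂ →L[ℝ] ℂ →L[ℝ] ℂ) (a : ℂ) :
    B a a + B (Complex.I * a) (Complex.I * a) = ‖a‖ ^ 2 • (B 1 1 + B Complex.I Complex.I) := by
  have h1 : a = a.re • (1 : ℂ) + a.im • Complex.I := by
    rw [Complex.real_smul, Complex.real_smul, mul_one, Complex.re_add_im]
  have h2 : Complex.I * a = a.re • Complex.I + (-a.im) • (1 : ℂ) := by
    apply Complex.ext <;> simp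
  have h3 : ‖a‖ ^ 2 = a.re ^ 2 + a.im ^ 2 := by
    rw [← Complex.normSq_eq_norm_sq, Complex.normSq_apply]; ring
  rw [h3, h2]
  nth_rw 1 2 [h1]
  simp only [map_add, map_smul, add_apply, smul_apply]
  module

lemma laplacian_eq_fderiv_fderiv (F : ℂ → ℂ) (z : ℂ) :
    Laplacian.laplacian F z = fderiv ℝ (fderiv ℝ F) z 1 1
      + fderiv ℝ (fderiv ℝ F) z Complex.I Complex.I := by
  rw [InnerProductSpace.laplacian_eq_iteratedFDeriv_complexPlane]
  simp [iteratedFDeriv_two_apply]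

/-! ### The radial equation of the first mode and the estimate at the centre -/

section Disc

variable {F : ℂ → ℂ} {b : ℝ}

lemma continuousOn_fderiv_ball (hF : ContDiffOn ℝ 2 F (ball 0 b)) :
    ContinuousOn (fderiv ℝ F) (ball 0 b) :=
  hF.continuousOn_fderiv_of_isOpen isOpen_ball (by norm_num)

lemma contDiffOn_fderiv_ball (hF : ContDiffOn ℝ 2 F (ball 0 b)) :
    ContDiffOn ℝ 1 (fderiv ℝ F) (ball 0 b) :=
  hF.fderiv_of_isOpen isOpen_ball (by norm_num)

lemma continuousOn_fderiv_fderiv_ball (hF : ContDiffOn ℝ 2 F (ball 0 b)) :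
    ContinuousOn (fderiv ℝ (fderiv ℝ F)) (ball 0 b) :=
  (contDiffOn_fderiv_ball hF).continuousOn_fderiv_of_isOpen isOpen_ball (by norm_num)

lemma hasFDerivAt_of_contDiffOn_ball (hF : ContDiffOn ℝ 2 F (ball 0 b)) {z : ℂ}
    (hz : z ∈ ball (0 : ℂ) b) : HasFDerivAt F (fderiv ℝ F z) z :=
  ((hF.contDiffAt (isOpen_ball.mem_nhds hz)).differentiableAt (by norm_num)).hasFDerivAt

lemma hasFDerivAt_fderiv_of_contDiffOn_ball (hF : ContDiffOn ℝ 2 F (ball 0 b)) {z : ℂ}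
    (hz : z ∈ ball (0 : ℂ) b) : HasFDerivAt (fderiv ℝ F) (fderiv ℝ (fderiv ℝ F) z) z :=
  (((contDiffOn_fderiv_ball hF).contDiffAt (isOpen_ball.mem_nhds hz)).differentiableAt
    (by norm_num)).hasFDerivAt

lemma continuousOn_laplacian_ball (hF : ContDiffOn ℝ 2 F (ball 0 b)) :
    ContinuousOn (Laplacian.laplacian F) (ball 0 b) := by
  have h := continuousOn_fderiv_fderiv_ball hF
  refine ContinuousOn.congr (f := fun z => fderiv ℝ (fderiv ℝ F) z 1 1
      + fderiv ℝ (fderiv ℝ F) z Complex.I Complex.I) ?_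
    fun z _ => laplacian_eq_fderiv_fderiv F z
  fun_prop

lemma mul_circleMap_mem_ball {x : ℝ} (hx : x ∈ ball (0 : ℝ) b) (t : ℝ) :
    (x : ℂ) * circleMap 0 1 t ∈ ball (0 : ℂ) b := by
  simpa using hx

lemma hasDerivAt_mul_circleMap_left (x t : ℝ) :
    HasDerivAt (fun y : ℝ => (y : ℂ) * circleMap 0 1 t) (circleMap 0 1 t) x := by
  simpa using (Complex.ofRealCLM.hasDerivAt (x := x)).mul_const (circleMap 0 1 t)

lemma hasDerivAt_mul_circleMap_right (x t : ℝ) :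
    HasDerivAt (fun s : ℝ => (x : ℂ) * circleMap 0 1 s) (Complex.I * (x * circleMap 0 1 t)) t := by
  refine ((hasDerivAt_circleMap 0 1 t).const_mul (x : ℂ)).congr_deriv ?_
  ring

/-- The integrals of `F` on the circles about `0` against `2 Re (conj ξ * e^{it})`. -/
noncomputable def firstMode (F : ℂ → ℂ) (ξ : ℂ) (x : ℝ) : ℂ :=
  ∫ t in (0 : ℝ)..2 * Real.pi, dirCos ξ t • F (x * circleMap 0 1 t)

/-- The derivative of `firstMode`. -/
noncomputable def firstModeDeriv (F : ℂ → ℂ) (ξ : ℂ) (x : ℝ) : ℂ :=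
  ∫ t in (0 : ℝ)..2 * Real.pi,
    dirCos ξ t • fderiv ℝ F (x * circleMap 0 1 t) (circleMap 0 1 t)

lemma continuousOn_prod_comp {G : Type*} [TopologicalSpace G] {g : ℂ → G}
    (hg : ContinuousOn g (ball 0 b)) :
    ContinuousOn (fun p : ℝ × ℝ => g (p.1 * circleMap 0 1 p.2)) (ball (0 : ℝ) b ×ˢ univ) :=
  hg.comp (by fun_prop) fun p hp => mul_circleMap_mem_ball hp.1 p.2

lemma continuous_comp_mul_circleMap {G : Type*} [TopologicalSpace G] {g : ℂ → G}
    (hg : ContinuousOn g (ball 0 b)) {x : ℝ} (hx : x ∈ ball (0 : ℝ) b) :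
    Continuous fun t : ℝ => g (x * circleMap 0 1 t) :=
  hg.comp_continuous (by fun_prop) fun t => mul_circleMap_mem_ball hx t

lemma hasDerivAt_comp_mul_circleMap_left (hF : ContDiffOn ℝ 2 F (ball 0 b)) {x : ℝ}
    (hx : x ∈ ball (0 : ℝ) b) (t : ℝ) :
    HasDerivAt (fun y : ℝ => F (y * circleMap 0 1 t))
      (fderiv ℝ F (x * circleMap 0 1 t) (circleMap 0 1 t)) x :=
  (hasFDerivAt_of_contDiffOn_ball hF (mul_circleMap_mem_ball hx t)).comp_hasDerivAt x
    (hasDerivAt_mul_circleMap_left x t)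

lemma hasDerivAt_fderiv_comp_mul_circleMap_left (hF : ContDiffOn ℝ 2 F (ball 0 b)) {x : ℝ}
    (hx : x ∈ ball (0 : ℝ) b) (t : ℝ) :
    HasDerivAt (fun y : ℝ => fderiv ℝ F (y * circleMap 0 1 t))
      (fderiv ℝ (fderiv ℝ F) (x * circleMap 0 1 t) (circleMap 0 1 t)) x :=
  (hasFDerivAt_fderiv_of_contDiffOn_ball hF (mul_circleMap_mem_ball hx t)).comp_hasDerivAt x
    (hasDerivAt_mul_circleMap_left x t)

lemma hasDerivAt_comp_mul_circleMap_right (hF : ContDiffOn ℝ 2 F (ball 0 b)) {x : ℝ}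
    (hx : x ∈ ball (0 : ℝ) b) (t : ℝ) :
    HasDerivAt (fun s : ℝ => F (x * circleMap 0 1 s))
      (fderiv ℝ F (x * circleMap 0 1 t) (Complex.I * (x * circleMap 0 1 t))) t :=
  (hasFDerivAt_of_contDiffOn_ball hF (mul_circleMap_mem_ball hx t)).comp_hasDerivAt t
    (hasDerivAt_mul_circleMap_right x t)

lemma hasDerivAt_fderiv_comp_mul_circleMap_right (hF : ContDiffOn ℝ 2 F (ball 0 b)) {x : ℝ}
    (hx : x ∈ ball (0 : ℝ) b) (t : ℝ) :
    HasDerivAt (fun s : ℝ => fderiv ℝ F (x * circleMap 0 1 s))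
      (fderiv ℝ (fderiv ℝ F) (x * circleMap 0 1 t) (Complex.I * (x * circleMap 0 1 t))) t :=
  (hasFDerivAt_fderiv_of_contDiffOn_ball hF (mul_circleMap_mem_ball hx t)).comp_hasDerivAt t
    (hasDerivAt_mul_circleMap_right x t)

lemma hasDerivAt_firstMode (hF : ContDiffOn ℝ 2 F (ball 0 b)) (ξ : ℂ) {x : ℝ}
    (hx : x ∈ ball (0 : ℝ) b) : HasDerivAt (firstMode F ξ) (firstModeDeriv F ξ x) x := by
  have hq := continuous_dirCos ξ
  refine hasDerivAt_intervalIntegral_of_continuousOn (U := ball (0 : ℝ) b)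
    (H := fun y t => dirCos ξ t • F (y * circleMap 0 1 t))
    (H' := fun y t => dirCos ξ t • fderiv ℝ F (y * circleMap 0 1 t) (circleMap 0 1 t))
    isOpen_ball (fun y hy => ?_) (fun y hy t => ?_) ?_ hx 0 (2 * Real.pi)
  · exact hq.smul (continuous_comp_mul_circleMap hF.continuousOn hy)
  · exact (hasDerivAt_comp_mul_circleMap_left hF hy t).const_smul (dirCos ξ t)
  · exact (hq.comp continuous_snd).continuousOn.smul
      ((continuousOn_prod_comp (continuousOn_fderiv_ball hF)).clm_apply
        ((continuous_circleMap 0 1).comp continuous_snd).continuousOn)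

lemma hasDerivAt_firstModeDeriv (hF : ContDiffOn ℝ 2 F (ball 0 b)) (ξ : ℂ) {x : ℝ}
    (hx : x ∈ ball (0 : ℝ) b) : HasDerivAt (firstModeDeriv F ξ)
      (∫ t in (0 : ℝ)..2 * Real.pi, dirCos ξ t •
        fderiv ℝ (fderiv ℝ F) (x * circleMap 0 1 t) (circleMap 0 1 t) (circleMap 0 1 t)) x := by
  have hq := continuous_dirCos ξ
  refine hasDerivAt_intervalIntegral_of_continuousOn (U := ball (0 : ℝ) b)
    (H := fun y t => dirCos ξ t • fderiv ℝ F (y * circleMap 0 1 t) (circleMap 0 1 t))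
    (H' := fun y t => dirCos ξ t •
      fderiv ℝ (fderiv ℝ F) (y * circleMap 0 1 t) (circleMap 0 1 t) (circleMap 0 1 t))
    isOpen_ball (fun y hy => ?_) (fun y hy t => ?_) ?_ hx 0 (2 * Real.pi)
  · exact hq.smul ((continuous_comp_mul_circleMap (continuousOn_fderiv_ball hF) hy).clm_apply
      (continuous_circleMap 0 1))
  · have h2 := (hasDerivAt_fderiv_comp_mul_circleMap_left hF hy t).clm_apply
      (hasDerivAt_const y (circleMap 0 1 t))
    simp only [map_zero, add_zero] at h2
    exact h2.const_smul (dirCos ξ t)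
  · have he : ContinuousOn (fun p : ℝ × ℝ => circleMap 0 1 p.2) (ball (0 : ℝ) b ×ˢ univ) :=
      ((continuous_circleMap 0 1).comp continuous_snd).continuousOn
    exact (hq.comp continuous_snd).continuousOn.smul
      (((continuousOn_prod_comp (continuousOn_fderiv_fderiv_ball hF)).clm_apply he).clm_apply he)

lemma firstMode_zero (F : ℂ → ℂ) (ξ : ℂ) : firstMode F ξ 0 = 0 := by
  simpa [firstMode] using integral_dirCos_smul_const ξ (F 0)

/-- At x = 0 the derivative of F no longer depends on the angle and comes out of the integral. -/
lemma firstModeDeriv_zero (F : ℂ → ℂ) (ξ : ℂ) :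
    firstModeDeriv F ξ 0 = (2 * Real.pi) • fderiv ℝ F 0 ξ := by
  rw [← map_smul, ← integral_dirCos_smul_circleMap, ← ContinuousLinearMap.intervalIntegral_comp_comm]
  · simp only [firstModeDeriv, Complex.ofReal_zero, zero_mul, map_smul]
  · exact ((continuous_dirCos ξ).smul (continuous_circleMap 0 1)).intervalIntegrable _ _

/-- Integration by parts in the angular variable. -/
lemma integral_dirCos_smul_angular (hF : ContDiffOn ℝ 2 F (ball 0 b)) (ξ : ℂ) {x : ℝ}
    (hx : x ∈ ball (0 : ℝ) b) :
    ∫ t in (0 : ℝ)..2 * Real.pi, dirCos ξ t •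
      (fderiv ℝ (fderiv ℝ F) (x * circleMap 0 1 t) (Complex.I * (x * circleMap 0 1 t))
          (Complex.I * (x * circleMap 0 1 t))
        - fderiv ℝ F (x * circleMap 0 1 t) (x * circleMap 0 1 t) + F (x * circleMap 0 1 t)) = 0 := by
  have hq := continuous_dirCos ξ
  have c0 := continuous_comp_mul_circleMap hF.continuousOn hx
  have c1 := continuous_comp_mul_circleMap (continuousOn_fderiv_ball hF) hx
  have c2 := continuous_comp_mul_circleMap (continuousOn_fderiv_fderiv_ball hF) hx
  have he : Continuous fun t : ℝ => (x : ℂ) * circleMap 0 1 t := by fun_prop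
  have hIe : Continuous fun t : ℝ => Complex.I * ((x : ℂ) * circleMap 0 1 t) := by fun_prop
  -- The antiderivative is q ∂ₜF - q' ∙ F, which is periodic; q' is `dirCos (-(I * ξ))`, and q'' =
  -- -q creates the term +F.
  have h := intervalIntegral.integral_eq_sub_of_hasDerivAt (a := 0) (b := 2 * Real.pi)
    (f := fun t => dirCos ξ t •
        fderiv ℝ F (x * circleMap 0 1 t) (Complex.I * (x * circleMap 0 1 t))
      - dirCos (-(Complex.I * ξ)) t • F (x * circleMap 0 1 t))
    (f' := fun t => dirCos ξ t •
      (fderiv ℝ (fderiv ℝ F) (x * circleMap 0 1 t) (Complex.I * (x * circleMap 0 1 t))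
          (Complex.I * (x * circleMap 0 1 t))
        - fderiv ℝ F (x * circleMap 0 1 t) (x * circleMap 0 1 t) + F (x * circleMap 0 1 t)))
    (fun t _ => ?_)
    ((hq.smul ((((c2.clm_apply hIe).clm_apply hIe).sub (c1.clm_apply he)).add
      c0)).intervalIntegrable _ _)
  · rw [h]
    simp only [dirCos_two_pi, circleMap_two_pi, sub_self]
  · have d0 := hasDerivAt_comp_mul_circleMap_right hF hx t
    have d1 := (hasDerivAt_fderiv_comp_mul_circleMap_right hF hx t).clm_apply
      ((hasDerivAt_mul_circleMap_right x t).const_mul Complex.I)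
    have := ((hasDerivAt_dirCos ξ t).smul d1).sub ((hasDerivAt_dirCos (-(Complex.I * ξ)) t).smul d0)
    refine this.congr_deriv ?_
    have e1 : Complex.I * (Complex.I * (x * circleMap 0 1 t)) = -(x * circleMap 0 1 t) := by
      rw [← mul_assoc, Complex.I_mul_I, neg_one_mul]
    have e2 : -(Complex.I * -(Complex.I * ξ)) = -ξ := by
      rw [mul_neg, neg_neg, ← mul_assoc, Complex.I_mul_I, neg_one_mul]
    simp only [e1, e2, map_neg, dirCos_neg]
    module

/-- In polar coordinates Δ = ∂ₓ² + ∂ₓ/x + ∂ₜ²/x², and ∂ₜ² acts as -1 on the first mode. -/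
lemma firstMode_ode (hF : ContDiffOn ℝ 2 F (ball 0 b)) (ξ : ℂ) {x : ℝ} (hx0 : x ≠ 0)
    (hx : x ∈ ball (0 : ℝ) b) :
    (∫ t in (0 : ℝ)..2 * Real.pi, dirCos ξ t •
        fderiv ℝ (fderiv ℝ F) (x * circleMap 0 1 t) (circleMap 0 1 t) (circleMap 0 1 t))
      + firstModeDeriv F ξ x / x - firstMode F ξ x / x ^ 2
      = ∫ t in (0 : ℝ)..2 * Real.pi, dirCos ξ t • Laplacian.laplacian F (x * circleMap 0 1 t) := by
  have hq := continuous_dirCos ξ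
  have c0 := continuous_comp_mul_circleMap hF.continuousOn hx
  have c1 := continuous_comp_mul_circleMap (continuousOn_fderiv_ball hF) hx
  have c2 := continuous_comp_mul_circleMap (continuousOn_fderiv_fderiv_ball hF) hx
  have he := continuous_circleMap 0 1
  have hxe : Continuous fun t : ℝ => (x : ℂ) * circleMap 0 1 t := by fun_prop
  have hIe : Continuous fun t : ℝ => Complex.I * ((x : ℂ) * circleMap 0 1 t) := by fun_prop
  have i0 := (hq.smul c0).const_smul ((x ^ 2)⁻¹ : ℝ)
  have i1 := (hq.smul (c1.clm_apply he)).const_smul (x⁻¹ : ℝ)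
  have i2 := hq.smul ((c2.clm_apply he).clm_apply he)
  have i3 := (hq.smul ((((c2.clm_apply hIe).clm_apply hIe).sub (c1.clm_apply hxe)).add
    c0)).const_smul ((x ^ 2)⁻¹ : ℝ)
  have hxc : (x : ℂ) ≠ 0 := by exact_mod_cast hx0
  have key := integral_dirCos_smul_angular hF ξ hx
  have e1 : firstModeDeriv F ξ x / x = ∫ t in (0 : ℝ)..2 * Real.pi, (x⁻¹ : ℝ) • (dirCos ξ t •
      fderiv ℝ F (x * circleMap 0 1 t) (circleMap 0 1 t)) := by
    rw [intervalIntegral.integral_smul, firstModeDeriv, Complex.real_smul, div_eq_inv_mul,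
      Complex.ofReal_inv]
  have e2 : firstMode F ξ x / x ^ 2 = ∫ t in (0 : ℝ)..2 * Real.pi, ((x ^ 2)⁻¹ : ℝ) •
      (dirCos ξ t • F (x * circleMap 0 1 t)) := by
    rw [intervalIntegral.integral_smul, firstMode, Complex.real_smul, div_eq_inv_mul,
      Complex.ofReal_inv, Complex.ofReal_pow]
  have e3 : (∫ t in (0 : ℝ)..2 * Real.pi, ((x ^ 2)⁻¹ : ℝ) • (dirCos ξ t •
      (fderiv ℝ (fderiv ℝ F) (x * circleMap 0 1 t) (Complex.I * (x * circleMap 0 1 t))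
          (Complex.I * (x * circleMap 0 1 t))
        - fderiv ℝ F (x * circleMap 0 1 t) (x * circleMap 0 1 t) + F (x * circleMap 0 1 t)))) = 0 := by
    rw [intervalIntegral.integral_smul, key, smul_zero]
  -- Adding the vanishing angular integral turns the claim into a pointwise identity of integrands.
  refine (add_zero _).symm.trans ((congrArg (_ + ·) e3.symm).trans ?_)
  rw [e1, e2, ← intervalIntegral.integral_add,
    ← intervalIntegral.integral_sub, ← intervalIntegral.integral_add]
  · refine intervalIntegral.integral_congr fun t _ => ?_
    have hm : (x : ℂ) * circleMap 0 1 t = x • circleMap 0 1 t := by rw [Complex.real_smul]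
    have hI : Complex.I * ((x : ℂ) * circleMap 0 1 t) = x • (Complex.I * circleMap 0 1 t) := by
      rw [Complex.real_smul]; ring
    have hb := bilin_add_bilin_I_mul (fderiv ℝ (fderiv ℝ F) (x * circleMap 0 1 t)) (circleMap 0 1 t)
    rw [norm_circleMap_zero, abs_one, one_pow, one_smul, ← laplacian_eq_fderiv_fderiv] at hb
    rw [← hb]
    generalize fderiv ℝ (fderiv ℝ F) ((x : ℂ) * circleMap 0 1 t) = B₂
    generalize fderiv ℝ F ((x : ℂ) * circleMap 0 1 t) = B₁
    generalize F ((x : ℂ) * circleMap 0 1 t) = B₀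
    rw [hI, hm]
    simp only [map_smul, smul_apply]
    simp only [Complex.real_smul]
    push_cast
    field_simp
    ring
  all_goals
    refine Continuous.intervalIntegrable ?_ _ _
  · exact (i2.add i1).sub i0
  · exact i3
  · exact i2.add i1
  · exact i0
  · exact i2
  · exact i1

/-- The gradient at the centre of a disc in terms of the boundary values and the Laplacian. -/
theorem norm_firstMode_sub_fderiv_le (hb : 1 < b) (hF : ContDiffOn ℝ 2 F (ball 0 b)) {ξ : ℂ}
    (hξ : ‖ξ‖ = 1) {β β' : ℝ → ℝ} (hβ : ∀ x ∈ Icc (0 : ℝ) 1, HasDerivAt β (β' x) x)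
    (bound : ∀ x ∈ Ioo (0 : ℝ) 1, (1 - x ^ 2) * ∫ t in (0 : ℝ)..2 * Real.pi,
      ‖Laplacian.laplacian F (x * circleMap 0 1 t)‖ ≤ β' x) :
    ‖firstMode F ξ 1 - (2 * Real.pi) • fderiv ℝ F 0 ξ‖ ≤ β 1 - β 0 := by
  have hmem : ∀ x ∈ Icc (0 : ℝ) 1, x ∈ ball (0 : ℝ) b := fun x hx => by
    rw [mem_ball_zero_iff, Real.norm_eq_abs, abs_of_nonneg hx.1]; linarith [hx.2]
  set A := firstMode F ξ with hA
  set A' := firstModeDeriv F ξ with hA'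
  -- The weight (1 - x²)/2 is that of the Green function of the first mode. `W` is the primitive of
  -- (1 - x²)/2 times A'' + A'/x - A/x², normalised so that `W 1 = A 1`.
  set W : ℝ → ℂ := fun x => (1 / 2 : ℂ) * (1 - (x : ℂ) ^ 2) * (A' x + A x / x) + x * A x with hW
  have hWd : ∀ x ∈ Ioc (0 : ℝ) 1, HasDerivAt W ((1 / 2 : ℂ) * (1 - (x : ℂ) ^ 2) *
      ∫ t in (0 : ℝ)..2 * Real.pi, dirCos ξ t • Laplacian.laplacian F (x * circleMap 0 1 t)) x := by
    intro x hx
    have hxb := hmem x ⟨hx.1.le, hx.2⟩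
    have hxc : (x : ℂ) ≠ 0 := by exact_mod_cast hx.1.ne'
    have dA := hasDerivAt_firstMode hF ξ hxb
    have dA' := hasDerivAt_firstModeDeriv hF ξ hxb
    have dx : HasDerivAt (fun y : ℝ => (y : ℂ)) 1 x := Complex.ofRealCLM.hasDerivAt (x := x)
    rw [← firstMode_ode hF ξ hx.1.ne' hxb]
    have := ((((dx.pow 2).const_sub 1).const_mul (1 / 2 : ℂ)).mul (dA'.add (dA.div dx hxc))).add
      (dx.mul dA)
    refine this.congr_deriv ?_
    simp only [Pi.add_apply, Pi.div_apply, Nat.cast_ofNat, Nat.add_one_sub_one, pow_one,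
      Pi.pow_apply]
    field_simp
    ring
  have hW0 : Tendsto W (𝓝[>] 0) (𝓝 ((2 * Real.pi) • fderiv ℝ F 0 ξ)) := by
    have h0 := hmem 0 (by simp)
    have dA := hasDerivAt_firstMode hF ξ h0
    have dA' := hasDerivAt_firstModeDeriv hF ξ h0
    have hc : Tendsto (fun x : ℝ => (x : ℂ)) (𝓝[>] 0) (𝓝 0) :=
      (Complex.continuous_ofReal.tendsto' 0 0 (by simp)).mono_left nhdsWithin_le_nhds
    have l1 : Tendsto A' (𝓝[>] 0) (𝓝 (A' 0)) := dA'.continuousAt.tendsto.mono_left nhdsWithin_le_nhds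
    have l2 : Tendsto A (𝓝[>] 0) (𝓝 (A 0)) := dA.continuousAt.tendsto.mono_left nhdsWithin_le_nhds
    have l3 : Tendsto (fun x : ℝ => A x / x) (𝓝[>] 0) (𝓝 (A' 0)) := by
      have := dA.tendsto_slope.mono_left (nhdsGT_le_nhdsNE (0 : ℝ))
      refine this.congr fun x => ?_
      rw [slope_def_module, ← hA, hA, firstMode_zero, sub_zero, sub_zero, Complex.real_smul,
        Complex.ofReal_inv, div_eq_inv_mul]
    have := (((hc.pow 2).const_sub 1).const_mul (1 / 2 : ℂ)).mul (l1.add l3) |>.add (hc.mul l2)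
    convert this using 2
    rw [← firstModeDeriv_zero, ← hA']
    ring
  have hW1 : W 1 = A 1 := by simp [hW]
  -- The comparison runs on [ε, 1]: with `A 0 / 0 = 0`, the value `W 0` is only half of the limit
  -- A'(0), so `W` cannot be used at 0 itself.
  have hε : ∀ᶠ ε in 𝓝[>] (0 : ℝ), ‖W 1 - W ε‖ ≤ β 1 - β ε := by
    filter_upwards [Ioo_mem_nhdsGT (one_pos (α := ℝ))] with ε hε
    refine image_norm_le_of_norm_deriv_right_le_deriv_boundary' (f := fun x => W x - W ε)
      (B := fun x => β x - β ε) (B' := β') (a := ε) (b := 1)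
      (fun x hx => ((hWd x ⟨hε.1.trans_le hx.1, hx.2⟩).continuousAt.sub
        continuousAt_const).continuousWithinAt)
      (fun x hx => ((hWd x ⟨hε.1.trans_le hx.1, hx.2.le⟩).sub_const _).hasDerivWithinAt) (by simp)
      (fun x hx => ((hβ x ⟨hε.1.le.trans hx.1, hx.2⟩).continuousAt.sub
        continuousAt_const).continuousWithinAt)
      (fun x hx => ((hβ x ⟨hε.1.le.trans hx.1, hx.2.le⟩).sub_const _).hasDerivWithinAt)
      (fun x hx => ?_) (right_mem_Icc.2 hε.2.le)
    have hx' : x ∈ Ioo (0 : ℝ) 1 := ⟨hε.1.trans_le hx.1, hx.2⟩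
    have hxb := hmem x ⟨hx'.1.le, hx'.2.le⟩
    refine le_trans ?_ (bound x hx')
    have hpos : 0 ≤ 1 - x ^ 2 := by nlinarith [hx'.1, hx'.2]
    have cL := continuous_comp_mul_circleMap (continuousOn_laplacian_ball hF) hxb
    have hI : ‖∫ t in (0 : ℝ)..2 * Real.pi, dirCos ξ t • Laplacian.laplacian F (x * circleMap 0 1 t)‖
        ≤ 2 * ∫ t in (0 : ℝ)..2 * Real.pi, ‖Laplacian.laplacian F (x * circleMap 0 1 t)‖ := by
      rw [← intervalIntegral.integral_const_mul]
      refine intervalIntegral.norm_integral_le_of_norm_le (by positivity)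
        (Eventually.of_forall fun t _ => ?_)
        ((continuous_const.mul cL.norm).intervalIntegrable _ _)
      rw [norm_smul, Real.norm_eq_abs]
      gcongr
      simpa [hξ] using abs_dirCos_le ξ t
    have hn : ‖(1 / 2 : ℂ) * (1 - (x : ℂ) ^ 2)‖ = (1 - x ^ 2) / 2 := by
      have : (1 / 2 : ℂ) * (1 - (x : ℂ) ^ 2) = (((1 - x ^ 2) / 2 : ℝ) : ℂ) := by push_cast; ring
      rw [this, Complex.norm_real, Real.norm_eq_abs, abs_of_nonneg (by linarith)]
    rw [norm_mul, hn]
    calc _ ≤ (1 - x ^ 2) / 2 * (2 * _) := mul_le_mul_of_nonneg_left hI (by linarith)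
      _ = _ := by ring
  have l1 : Tendsto (fun ε => ‖W 1 - W ε‖) (𝓝[>] 0)
      (𝓝 ‖A 1 - (2 * Real.pi) • fderiv ℝ F 0 ξ‖) := by
    rw [← hW1]
    exact (tendsto_const_nhds.sub hW0).norm
  have l2 : Tendsto (fun ε => β 1 - β ε) (𝓝[>] 0) (𝓝 (β 1 - β 0)) :=
    tendsto_const_nhds.sub
      ((hβ 0 (by simp)).continuousAt.tendsto.mono_left nhdsWithin_le_nhds)
  exact le_of_tendsto_of_tendsto l1 l2 hε

end Disc

/-! ### Möbius maps, change of variables on the circle, and the gradient kernel -/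

open ComplexConjugate in
/-- The Möbius transformation of the disc that maps `0` to `z`. -/
noncomputable def discMoebius (z ζ : ℂ) : ℂ := (ζ + z) / (1 + conj z * ζ)

section Moebius

open ComplexConjugate

lemma one_add_conj_mul_ne_zero {z ζ : ℂ} (hz : ‖z‖ < 1) (hζ : ‖ζ‖ ≤ 1) : 1 + conj z * ζ ≠ 0 := by
  intro h
  have h1 : conj z * ζ = -1 := by linear_combination h
  have h2 : ‖z‖ * ‖ζ‖ = 1 := by
    rw [← RCLike.norm_conj z, ← norm_mul, h1, norm_neg, norm_one]
  nlinarith [norm_nonneg z, norm_nonneg ζ]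

lemma one_sub_sq_norm_pos {z : ℂ} (hz : ‖z‖ < 1) : 0 < 1 - ‖z‖ ^ 2 := by
  nlinarith [norm_nonneg z]

lemma hasDerivAt_discMoebius {z ζ : ℂ} (h : 1 + conj z * ζ ≠ 0) :
    HasDerivAt (discMoebius z) ((1 - ‖z‖ ^ 2 : ℝ) / (1 + conj z * ζ) ^ 2) ζ := by
  have h1 : HasDerivAt (fun ζ => 1 + conj z * ζ) (conj z) ζ := by
    simpa using ((hasDerivAt_id ζ).const_mul (conj z)).const_add 1
  refine (((hasDerivAt_id ζ).add_const z).div h1 h).congr_deriv ?_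
  have h2 : conj z * z = ((‖z‖ ^ 2 : ℝ) : ℂ) := by rw [Complex.conj_mul']; push_cast; rfl
  push_cast at h2 ⊢
  rw [← h2]
  simp only [id]
  congr 1
  ring

lemma discMoebius_zero (z : ℂ) : discMoebius z 0 = z := by simp [discMoebius]

lemma one_sub_sq_norm_discMoebius {z ζ : ℂ} (h : 1 + conj z * ζ ≠ 0) :
    1 - ‖discMoebius z ζ‖ ^ 2 = (1 - ‖z‖ ^ 2) * (1 - ‖ζ‖ ^ 2) / ‖1 + conj z * ζ‖ ^ 2 := by
  have hn : ‖1 + conj z * ζ‖ ^ 2 ≠ 0 := by simpa using h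
  rw [discMoebius, norm_div, div_pow, eq_div_iff hn, sub_mul, div_mul_cancel₀ _ hn, one_mul]
  simp only [← Complex.normSq_eq_norm_sq, Complex.normSq_apply]
  simp
  ring

lemma norm_discMoebius_lt_one {z ζ : ℂ} (hz : ‖z‖ < 1) (hζ : ‖ζ‖ < 1) : ‖discMoebius z ζ‖ < 1 := by
  have h := one_add_conj_mul_ne_zero hz hζ.le
  have h1 := one_sub_sq_norm_discMoebius h
  have h2 : 0 < (1 - ‖z‖ ^ 2) * (1 - ‖ζ‖ ^ 2) / ‖1 + conj z * ζ‖ ^ 2 :=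
    div_pos (mul_pos (one_sub_sq_norm_pos hz) (one_sub_sq_norm_pos hζ))
      (by have := norm_pos_iff.2 h; positivity)
  nlinarith [norm_nonneg (discMoebius z ζ)]

lemma norm_discMoebius_eq_one {z ζ : ℂ} (hz : ‖z‖ < 1) (hζ : ‖ζ‖ = 1) : ‖discMoebius z ζ‖ = 1 := by
  have h1 := one_sub_sq_norm_discMoebius (one_add_conj_mul_ne_zero hz hζ.le)
  rw [hζ] at h1
  norm_num at h1
  have h2 : (‖discMoebius z ζ‖ - 1) * (‖discMoebius z ζ‖ + 1) = 0 := by linear_combination -h1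
  rcases mul_eq_zero.1 h2 with h3 | h3
  · linarith
  · linarith [norm_nonneg (discMoebius z ζ)]

lemma one_sub_conj_mul_discMoebius {z ζ : ℂ} (h : 1 + conj z * ζ ≠ 0) :
    1 - conj z * discMoebius z ζ = (1 - ‖z‖ ^ 2 : ℝ) / (1 + conj z * ζ) := by
  have h2 : conj z * z = ((‖z‖ ^ 2 : ℝ) : ℂ) := by rw [Complex.conj_mul']; push_cast; rfl
  rw [discMoebius, Complex.ofReal_sub, ← h2]
  field_simp
  push_cast
  ring

lemma discMoebius_neg_discMoebius {z ζ : ℂ} (hz : ‖z‖ < 1) (h : 1 + conj z * ζ ≠ 0) :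
    discMoebius (-z) (discMoebius z ζ) = ζ := by
  have h2 : conj z * z = ((‖z‖ ^ 2 : ℝ) : ℂ) := by rw [Complex.conj_mul']; push_cast; rfl
  have hp : ((1 - ‖z‖ ^ 2 : ℝ) : ℂ) ≠ 0 := by exact_mod_cast (one_sub_sq_norm_pos hz).ne'
  have h3 := one_sub_conj_mul_discMoebius h
  rw [discMoebius, map_neg, neg_mul, ← sub_eq_add_neg 1, h3]
  rw [discMoebius, div_eq_iff (div_ne_zero hp h), Complex.ofReal_sub, ← h2, div_add' _ _ _ h,
    ← mul_div_assoc]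
  congr 1
  push_cast
  ring

/-- The derivative of the angle `t - 2 arg (1 + conj z e^{it})` of `discMoebius z (e^{it})`. -/
lemma hasDerivAt_moebiusAngle {z : ℂ} (hz : ‖z‖ < 1) (t : ℝ) :
    HasDerivAt (fun t : ℝ => t - 2 * (Complex.log (1 + conj z * circleMap 0 1 t)).im)
      ((1 - ‖z‖ ^ 2) / ‖1 + conj z * circleMap 0 1 t‖ ^ 2) t := by
  have he : ‖circleMap 0 1 t‖ = 1 := by simp
  have hslit : 1 + conj z * circleMap 0 1 t ∈ Complex.slitPlane := by
    refine Complex.mem_slitPlane_of_norm_lt_one ?_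
    simpa [he] using hz
  have hne := Complex.slitPlane_ne_zero hslit
  have h1 : HasDerivAt (fun t : ℝ => 1 + conj z * circleMap 0 1 t)
      (conj z * (circleMap 0 1 t * Complex.I)) t :=
    ((hasDerivAt_circleMap 0 1 t).const_mul (conj z)).const_add 1
  have h2 := Complex.imCLM.hasFDerivAt.comp_hasDerivAt t (h1.clog_real hslit)
  refine ((hasDerivAt_id t).sub (h2.const_mul 2)).congr_deriv ?_
  have hn : Complex.normSq (1 + conj z * circleMap 0 1 t) ≠ 0 := by simpa using hne
  have hen : (circleMap 0 1 t).re * (circleMap 0 1 t).re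
      + (circleMap 0 1 t).im * (circleMap 0 1 t).im = 1 := by
    rw [← Complex.normSq_apply, Complex.normSq_eq_norm_sq, he, one_pow]
  rw [← Complex.normSq_eq_norm_sq, ← Complex.normSq_eq_norm_sq, eq_div_iff hn, Complex.imCLM_apply,
    Complex.div_im, sub_mul, mul_assoc 2, sub_mul, div_mul_cancel₀ _ hn, div_mul_cancel₀ _ hn]
  simp [Complex.normSq_apply]
  linear_combination (z.re * z.re + z.im * z.im) * (-1 : ℝ) * hen

/-- With w = 1 + conj z e^{it}, the numerator is e^{it} + z = e^{it} conj w, and conj w / w = e^{-2i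
arg w}. Since |w - 1| < 1, the principal argument gives a smooth lift of the boundary map. -/
lemma circleMap_moebiusAngle {z : ℂ} (hz : ‖z‖ < 1) (t : ℝ) :
    circleMap 0 1 (t - 2 * (Complex.log (1 + conj z * circleMap 0 1 t)).im)
      = discMoebius z (circleMap 0 1 t) := by
  have he : ‖circleMap 0 1 t‖ = 1 := by simp
  have hne := one_add_conj_mul_ne_zero hz he.le
  set w := 1 + conj z * circleMap 0 1 t with hw
  have hone : conj (circleMap 0 1 t) * circleMap 0 1 t = 1 := by
    rw [Complex.conj_mul', he]; simp
  have h1 : circleMap 0 1 t * conj w = circleMap 0 1 t + z := by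
    rw [hw]; simp only [map_add, map_one, map_mul, Complex.conj_conj]
    linear_combination z * hone
  rw [discMoebius, ← hw, ← h1, mul_div_assoc, Complex.log_im]
  have h2 : w = ‖w‖ * Complex.exp (w.arg * Complex.I) := (Complex.norm_mul_exp_arg_mul_I w).symm
  have h3 : conj w = ‖w‖ * Complex.exp (-(w.arg * Complex.I)) := by
    nth_rw 1 [h2]
    rw [map_mul, Complex.conj_ofReal, ← Complex.exp_conj]
    simp
  have h4 : conj w / w = Complex.exp (-(2 * w.arg * Complex.I)) := by
    have hn : (‖w‖ : ℂ) ≠ 0 := by simpa using hne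
    rw [h3]; nth_rw 3 [h2]
    rw [mul_div_mul_left _ _ hn, ← Complex.exp_sub]
    congr 1; ring
  rw [h4]
  simp only [circleMap, zero_add, Complex.ofReal_one, one_mul]
  rw [← Complex.exp_add]
  congr 1; push_cast; ring

/-- Change of variables on the unit circle by a Möbius transformation of the disc. -/
lemma integral_comp_discMoebius {E : Type*} [NormedAddCommGroup E] [NormedSpace ℝ E]
    {z : ℂ} (hz : ‖z‖ < 1) {H : ℂ → E} (hH : ContinuousOn H (sphere 0 1)) :
    ∫ t in (0 : ℝ)..2 * Real.pi, ((1 - ‖z‖ ^ 2) / ‖1 + conj z * circleMap 0 1 t‖ ^ 2) •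
      H (discMoebius z (circleMap 0 1 t)) = ∫ t in (0 : ℝ)..2 * Real.pi, H (circleMap 0 1 t) := by
  set θ : ℝ → ℝ := fun t => t - 2 * (Complex.log (1 + conj z * circleMap 0 1 t)).im with hθ
  have hc : Continuous fun t => H (circleMap 0 1 t) :=
    hH.comp_continuous (continuous_circleMap 0 1) (fun t => by simp)
  have hcont : Continuous fun t => (1 - ‖z‖ ^ 2) / ‖1 + conj z * circleMap 0 1 t‖ ^ 2 := by
    refine Continuous.div (by fun_prop) (by fun_prop) fun t => ?_
    simpa using one_add_conj_mul_ne_zero hz (by simp : ‖circleMap 0 1 t‖ ≤ 1)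
  have h := intervalIntegral.integral_deriv_smul_comp (a := 0) (b := 2 * Real.pi)
    (f := θ) (g := fun t => H (circleMap 0 1 t))
    (fun t _ => hasDerivAt_moebiusAngle hz t) hcont.continuousOn hc
  have hper : Function.Periodic (fun t => H (circleMap 0 1 t)) (2 * Real.pi) := fun t => by
    simp only [periodic_circleMap 0 1 t]
  -- The logarithm returns to its value after one turn, so the boundary map has degree one.
  have h2pi : θ (2 * Real.pi) = θ 0 + 2 * Real.pi := by
    simp only [hθ, circleMap_two_pi]; ring
  rw [h2pi, hper.intervalIntegral_add_eq (θ 0) 0, zero_add] at h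
  rw [← h]
  refine intervalIntegral.integral_congr fun t _ => ?_
  simp only [Function.comp_apply, hθ, circleMap_moebiusAngle hz]

/-- One factor |w|⁻² is the Jacobian of the Möbius map, and the other becomes |1 - conj z η|² up to
a constant. The latter is 1 + |z|² minus a first mode on the circle, whose mean is immediate. -/
lemma integral_one_div_norm_pow_four {z : ℂ} (hz : ‖z‖ < 1) :
    ∫ t in (0 : ℝ)..2 * Real.pi, 1 / ‖1 + conj z * circleMap 0 1 t‖ ^ 4
      = 2 * Real.pi * (1 + ‖z‖ ^ 2) / (1 - ‖z‖ ^ 2) ^ 3 := by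
  have hp := one_sub_sq_norm_pos hz
  have h := integral_comp_discMoebius hz (H := fun η => ‖1 - conj z * η‖ ^ 2 / (1 - ‖z‖ ^ 2) ^ 3)
    (by fun_prop)
  have h1 : ∀ t : ℝ, ‖1 - conj z * circleMap 0 1 t‖ ^ 2 / (1 - ‖z‖ ^ 2) ^ 3
      = ((1 + ‖z‖ ^ 2) - dirCos z t) / (1 - ‖z‖ ^ 2) ^ 3 := by
    intro t
    have he : ‖circleMap 0 1 t‖ = 1 := by simp
    congr 1
    rw [dirCos_eq_re, ← Complex.normSq_eq_norm_sq, Complex.normSq_sub, Complex.normSq_one,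
      Complex.normSq_eq_norm_sq, norm_mul, RCLike.norm_conj, he, one_mul, Complex.conj_re]
    ring
  simp_rw [h1] at h
  have h2 : ∫ t in (0 : ℝ)..2 * Real.pi, dirCos z t = 0 := by
    have := integral_dirCos_smul_const z 1
    simp only [Complex.real_smul, mul_one] at this
    rw [intervalIntegral.integral_ofReal] at this
    exact_mod_cast this
  rw [intervalIntegral.integral_div, intervalIntegral.integral_sub intervalIntegrable_const
    ((continuous_dirCos z).intervalIntegrable _ _), h2, intervalIntegral.integral_const, sub_zero,
    sub_zero, smul_eq_mul] at h
  rw [← h]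
  refine intervalIntegral.integral_congr fun t _ => ?_
  have hne := one_add_conj_mul_ne_zero hz (by simp : ‖circleMap 0 1 t‖ ≤ 1)
  have hn : ‖1 + conj z * circleMap 0 1 t‖ ≠ 0 := by simpa using hne
  simp only [one_sub_conj_mul_discMoebius hne, norm_div, Complex.norm_real, Real.norm_eq_abs,
    abs_of_pos hp, smul_eq_mul]
  field_simp

/-- The kernel that represents the derivative at `z` in the direction `ξ` of a harmonic function
by its boundary values. -/
noncomputable def gradKernel (z ξ η : ℂ) : ℝ := 2 * (conj ξ * η / (1 - conj z * η) ^ 2).re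

lemma one_sub_conj_mul_ne_zero {z ζ : ℂ} (hz : ‖z‖ < 1) (hζ : ‖ζ‖ ≤ 1) : 1 - conj z * ζ ≠ 0 := by
  have := one_add_conj_mul_ne_zero (z := -z) (by simpa using hz) hζ
  rwa [map_neg, neg_mul, ← sub_eq_add_neg] at this

lemma continuousOn_gradKernel {z : ℂ} (hz : ‖z‖ < 1) (ξ : ℂ) :
    ContinuousOn (gradKernel z ξ) (closedBall 0 1) := by
  have : ∀ η ∈ closedBall (0 : ℂ) 1, (1 - conj z * η) ^ 2 ≠ 0 := fun η hη =>
    pow_ne_zero 2 (one_sub_conj_mul_ne_zero hz (by simpa using hη))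
  unfold gradKernel
  refine continuousOn_const.mul (Complex.continuous_re.comp_continuousOn ?_)
  exact ContinuousOn.div (by fun_prop) (by fun_prop) this

/-- The Möbius pullback of the kernel, Jacobian included, is a multiple of the first mode:
differentiation at z becomes differentiation at 0. -/
lemma gradKernel_discMoebius {z : ℂ} (hz : ‖z‖ < 1) (ξ : ℂ) (t : ℝ) :
    (1 - ‖z‖ ^ 2) / ‖1 + conj z * circleMap 0 1 t‖ ^ 2 * gradKernel z ξ (discMoebius z (circleMap 0 1 t))
      = dirCos ξ t / (1 - ‖z‖ ^ 2) := by
  have hp := one_sub_sq_norm_pos hz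
  have he : ‖circleMap 0 1 t‖ = 1 := by simp
  have hne := one_add_conj_mul_ne_zero hz he.le
  have hone : conj (circleMap 0 1 t) * circleMap 0 1 t = 1 := by
    rw [Complex.conj_mul', he]; simp
  rw [gradKernel, one_sub_conj_mul_discMoebius hne, dirCos_eq_re, discMoebius]
  set w := 1 + conj z * circleMap 0 1 t with hw
  have hn : ‖w‖ ≠ 0 := by simpa using hne
  have h1 : circleMap 0 1 t + z = circleMap 0 1 t * conj w := by
    rw [hw]; simp only [map_add, map_one, map_mul, Complex.conj_conj]
    linear_combination -z * hone
  have h2 : w * conj w = ((‖w‖ ^ 2 : ℝ) : ℂ) := by rw [Complex.mul_conj']; push_cast; rfl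
  have hpc : ((1 - ‖z‖ ^ 2 : ℝ) : ℂ) ≠ 0 := by exact_mod_cast hp.ne'
  have h3 : conj ξ * ((circleMap 0 1 t + z) / w) / (((1 - ‖z‖ ^ 2 : ℝ) : ℂ) / w) ^ 2
      = ((‖w‖ ^ 2 / (1 - ‖z‖ ^ 2) ^ 2 : ℝ) : ℂ) * (conj ξ * circleMap 0 1 t) := by
    rw [h1, Complex.ofReal_div, ← h2, Complex.ofReal_pow]
    field_simp
  rw [h3, Complex.re_ofReal_mul]
  field_simp

lemma integral_gradKernel_smul {z : ℂ} (hz : ‖z‖ < 1) (ξ : ℂ) {h : ℂ → ℂ}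
    (hh : ContinuousOn h (sphere 0 1)) :
    ∫ t in (0 : ℝ)..2 * Real.pi, dirCos ξ t • h (discMoebius z (circleMap 0 1 t))
      = (1 - ‖z‖ ^ 2) • ∫ t in (0 : ℝ)..2 * Real.pi,
        gradKernel z ξ (circleMap 0 1 t) • h (circleMap 0 1 t) := by
  rw [← integral_comp_discMoebius hz (H := fun η => gradKernel z ξ η • h η)
    (((continuousOn_gradKernel hz ξ).mono sphere_subset_closedBall).smul hh),
    ← intervalIntegral.integral_smul]
  refine intervalIntegral.integral_congr fun t _ => ?_
  have hp := one_sub_sq_norm_pos hz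
  simp only [smul_smul]
  congr 1
  rw [gradKernel_discMoebius hz ξ t]
  field_simp

/-- Up to a rotation this is the integral of 2|sin|. The value 8, divided by 2π, is the constant
4/π. -/
lemma integral_abs_dirCos {ξ : ℂ} (hξ : ‖ξ‖ = 1) :
    ∫ t in (0 : ℝ)..2 * Real.pi, |dirCos ξ t| = 8 := by
  set c : ℝ := Real.pi / 2 - ξ.arg with hc
  have h1 : ∀ t, |dirCos ξ t| = 2 * |Real.sin (t + c)| := by
    intro t
    have hre : ξ.re = Real.cos ξ.arg := by
      rw [Complex.cos_arg (by rintro rfl; simp at hξ), hξ, div_one]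
    have him : ξ.im = Real.sin ξ.arg := by rw [Complex.sin_arg, hξ, div_one]
    have : t + c = Real.pi / 2 - (ξ.arg - t) := by rw [hc]; ring
    rw [this, Real.sin_pi_div_two_sub, Real.cos_sub, dirCos, hre, him, abs_mul, abs_two]
  have hper : Function.Periodic (fun t => |Real.sin t|) (2 * Real.pi) := fun t => by
    simp only [Real.sin_add_two_pi]
  have hi : ∀ a b : ℝ, IntervalIntegrable (fun t => |Real.sin t|) MeasureTheory.volume a b :=
    fun a b => Continuous.intervalIntegrable (by fun_prop) a b
  simp_rw [h1]
  rw [intervalIntegral.integral_const_mul,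
    intervalIntegral.integral_comp_add_right (fun t => |Real.sin t|), zero_add, add_comm _ c,
    hper.intervalIntegral_add_eq c 0, zero_add,
    ← intervalIntegral.integral_add_adjacent_intervals (hi 0 Real.pi) (hi _ _)]
  have e1 : ∫ t in (0 : ℝ)..Real.pi, |Real.sin t| = 2 := by
    have : ∫ t in (0 : ℝ)..Real.pi, Real.sin t = 2 := by simp [integral_sin]; norm_num
    rw [← this]
    refine intervalIntegral.integral_congr fun t ht => ?_
    rw [uIcc_of_le Real.pi_pos.le] at ht
    exact abs_of_nonneg (Real.sin_nonneg_of_mem_Icc ht)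
  have e2 : ∫ t in Real.pi..2 * Real.pi, |Real.sin t| = 2 := by
    have := intervalIntegral.integral_comp_add_right (a := 0) (b := Real.pi)
      (fun t => |Real.sin t|) Real.pi
    rw [zero_add, ← two_mul] at this
    rw [← this, ← e1]
    simp
  rw [e1, e2]; norm_num

lemma integral_abs_gradKernel {z ξ : ℂ} (hz : ‖z‖ < 1) (hξ : ‖ξ‖ = 1) :
    ∫ t in (0 : ℝ)..2 * Real.pi, |gradKernel z ξ (circleMap 0 1 t)| = 8 / (1 - ‖z‖ ^ 2) := by
  have hp := one_sub_sq_norm_pos hz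
  rw [← integral_comp_discMoebius hz (H := fun η => |gradKernel z ξ η|)
    ((continuousOn_gradKernel hz ξ).mono sphere_subset_closedBall).abs,
    ← integral_abs_dirCos hξ, ← intervalIntegral.integral_div]
  refine intervalIntegral.integral_congr fun t _ => ?_
  have hj : 0 ≤ (1 - ‖z‖ ^ 2) / ‖1 + conj z * circleMap 0 1 t‖ ^ 2 := by positivity
  simp only [smul_eq_mul]
  nth_rw 1 [← abs_of_nonneg hj]
  rw [← abs_mul, gradKernel_discMoebius hz ξ t, abs_div, abs_of_pos hp]

end Moebius

/-- The second derivative along u is D²h(φ'u, φ'u) + Dh(φ''u²). Summed over u = 1 and u = I, the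
last terms cancel because 1 + I² = 0. -/
lemma laplacian_comp_holomorphic {h φ φ' : ℂ → ℂ} {ζ : ℂ} {φ'' : ℂ}
    (hφ : ∀ᶠ w in 𝓝 ζ, HasDerivAt φ (φ' w) w) (hφ' : HasDerivAt φ' φ'' ζ)
    (hh : ContDiffAt ℝ 2 h (φ ζ)) :
    Laplacian.laplacian (h ∘ φ) ζ = ‖φ' ζ‖ ^ 2 • Laplacian.laplacian h (φ ζ) := by
  have hφc : ContinuousAt φ ζ := hφ.self_of_nhds.continuousAt
  have hev : ∀ᶠ w in 𝓝 ζ, ContDiffAt ℝ 2 h (φ w) := hφc.eventually (hh.eventually (by simp))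
  have hd2 : HasFDerivAt (fderiv ℝ h) (fderiv ℝ (fderiv ℝ h) (φ ζ)) (φ ζ) :=
    ((hh.fderiv_right (m := 1) (by norm_num)).differentiableAt (by norm_num)).hasFDerivAt
  have key : ∀ u : ℂ, fderiv ℝ (fderiv ℝ (h ∘ φ)) ζ u u
      = fderiv ℝ (fderiv ℝ h) (φ ζ) (φ' ζ * u) (φ' ζ * u) + fderiv ℝ h (φ ζ) (φ'' * (u * u)) := by
    intro u
    have h1 : (fun w => fderiv ℝ (h ∘ φ) w u) =ᶠ[𝓝 ζ] fun w => fderiv ℝ h (φ w) (φ' w * u) := by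
      filter_upwards [hφ, hev] with w hw1 hw2
      have := ((hw2.differentiableAt (by norm_num)).hasFDerivAt.comp w
        (hw1.hasFDerivAt.restrictScalars ℝ)).fderiv
      rw [this]
      simp [mul_comm]
    have hcomp : ContDiffAt ℝ 2 (h ∘ φ) ζ := by
      have hdo : DifferentiableOn ℂ φ {w | HasDerivAt φ (φ' w) w} := fun w hw =>
        hw.differentiableAt.differentiableWithinAt
      obtain ⟨U, hU1, hU2, hU3⟩ := _root_.mem_nhds_iff.1 hφ
      have : AnalyticAt ℂ φ ζ := (hdo.mono hU1).analyticAt (hU2.mem_nhds hU3)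
      exact hh.comp ζ ((this.contDiffAt (n := 2)).restrict_scalars ℝ)
    have h3 : HasFDerivAt (fderiv ℝ (h ∘ φ)) (fderiv ℝ (fderiv ℝ (h ∘ φ)) ζ) ζ :=
      ((hcomp.fderiv_right (m := 1) (by norm_num)).differentiableAt (by norm_num)).hasFDerivAt
    have h4 := (h3.clm_apply (hasFDerivAt_const u ζ)).congr_of_eventuallyEq h1.symm
    have h5 := (hd2.comp ζ (hφ.self_of_nhds.hasFDerivAt.restrictScalars ℝ)).clm_apply
      ((hφ'.mul_const u).hasFDerivAt.restrictScalars ℝ)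
    have h6 := congrArg (fun L : ℂ →L[ℝ] ℂ => L u) (h4.unique h5)
    simp at h6
    rw [h6, mul_comm u (φ' ζ), add_comm]
    congr 2
    ring
  have hI : Complex.I * Complex.I = -1 := Complex.I_mul_I
  rw [laplacian_eq_fderiv_fderiv, laplacian_eq_fderiv_fderiv, key, key, hI,
    ← bilin_add_bilin_I_mul, mul_comm Complex.I]
  simp only [mul_one, mul_neg, map_neg]
  ring

lemma discSup_ne_top_of_continuousOn {g : ℂ → ℂ} (hg : ContinuousOn g (closedBall 0 1)) :
    discSup g ≠ ∞ := by
  obtain ⟨C, hC⟩ := (isCompact_closedBall (0 : ℂ) 1).exists_bound_of_continuousOn hg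
  refine ne_top_of_le_ne_top (ENNReal.ofReal_ne_top (r := C)) (iSup₂_le fun z hz => ?_)
  rw [← ofReal_norm]
  exact ENNReal.ofReal_le_ofReal (hC z (ball_subset_closedBall hz))

lemma norm_le_toReal_discSup {h : ℂ → ℂ} (hh : discSup h ≠ ∞) {z : ℂ} (hz : z ∈ ball (0 : ℂ) 1) :
    ‖h z‖ ≤ (discSup h).toReal := by
  rw [← toReal_enorm]
  exact ENNReal.toReal_mono hh (le_iSup₂ (f := fun z (_ : z ∈ ball (0 : ℂ) 1) => ‖h z‖ₑ) z hz)

/-! ### The gradient bound -/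

section Gradient

open ComplexConjugate

/-- By compactness of the closed disc; the estimate at the centre asks for smoothness on a disc of
radius larger than 1. -/
lemma exists_ball_mapsTo_discMoebius {z : ℂ} (hz : ‖z‖ < 1) {b : ℝ} (hb : 1 < b) :
    ∃ c > 1, ∀ ζ ∈ ball (0 : ℂ) c, 1 + conj z * ζ ≠ 0 ∧ discMoebius z ζ ∈ ball (0 : ℂ) b := by
  set V : Set ℂ := {ζ | 1 + conj z * ζ ≠ 0} with hV
  have hVo : IsOpen V := isOpen_ne_fun (by fun_prop) (by fun_prop)
  have hc : ContinuousOn (discMoebius z) V := fun ζ hζ =>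
    (hasDerivAt_discMoebius hζ).continuousAt.continuousWithinAt
  have hU := hc.isOpen_inter_preimage hVo (isOpen_ball (x := (0 : ℂ)) (ε := b))
  have hsub : closedBall (0 : ℂ) 1 ⊆ V ∩ discMoebius z ⁻¹' ball 0 b := fun ζ hζ => by
    have hζ' : ‖ζ‖ ≤ 1 := by simpa using hζ
    refine ⟨one_add_conj_mul_ne_zero hz hζ', ?_⟩
    rw [mem_preimage, mem_ball_zero_iff]
    rcases hζ'.lt_or_eq with h | h
    · exact (norm_discMoebius_lt_one hz h).trans hb
    · rwa [norm_discMoebius_eq_one hz h]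
  obtain ⟨δ, hδ, hs⟩ := (isCompact_closedBall (0 : ℂ) 1).exists_thickening_subset_open hU hsub
  rw [thickening_closedBall hδ zero_le_one] at hs
  exact ⟨δ + 1, by linarith, fun ζ hζ => hs hζ⟩

/-- For a function that is `C²` on a neighbourhood of the closed disc, the derivative differs from
the one of the Poisson integral by at most `2 μ`. -/
theorem norm_integral_gradKernel_sub_fderiv_le {h : ℂ → ℂ} {b N : ℝ} (hb : 1 < b)
    (hh : ContDiffOn ℝ 2 h (ball 0 b))
    (hN : ∀ w ∈ ball (0 : ℂ) 1, ‖Laplacian.laplacian h w‖ ≤ N) {z ξ : ℂ} (hz0 : z ≠ 0)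
    (hz : ‖z‖ < 1) (hξ : ‖ξ‖ = 1) :
    ‖(2 * Real.pi)⁻¹ • (∫ t in (0 : ℝ)..2 * Real.pi,
        gradKernel z ξ (circleMap 0 1 t) • h (circleMap 0 1 t)) - fderiv ℝ h z ξ‖
      ≤ 2 * muFun N ‖z‖ := by
  obtain ⟨c, hc, hmap⟩ := exists_ball_mapsTo_discMoebius hz hb
  have hp := one_sub_sq_norm_pos hz
  set r := ‖z‖ with hr
  have hr0 : 0 < r := norm_pos_iff.2 hz0
  have hN0 : 0 ≤ N := (norm_nonneg _).trans (hN 0 (by simp))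
  have hd : ∀ ζ ∈ ball (0 : ℂ) c, HasDerivAt (discMoebius z)
      ((1 - ‖z‖ ^ 2 : ℝ) / (1 + conj z * ζ) ^ 2) ζ := fun ζ hζ =>
    hasDerivAt_discMoebius (hmap ζ hζ).1
  have hC2 : ContDiffOn ℝ 2 (h ∘ discMoebius z) (ball 0 c) := by
    refine hh.comp ?_ fun ζ hζ => (hmap ζ hζ).2
    have : DifferentiableOn ℂ (discMoebius z) (ball 0 c) := fun ζ hζ =>
      (hd ζ hζ).differentiableAt.differentiableWithinAt
    exact (this.contDiffOn isOpen_ball).restrict_scalars ℝ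
  have hlap : ∀ ζ ∈ ball (0 : ℂ) 1, ‖Laplacian.laplacian (h ∘ discMoebius z) ζ‖
      ≤ N * (1 - r ^ 2) ^ 2 * (1 / ‖1 + conj z * ζ‖ ^ 4) := by
    intro ζ hζ
    have hζc : ζ ∈ ball (0 : ℂ) c := ball_subset_ball hc.le hζ
    have hne := (hmap ζ hζc).1
    have hl : HasDerivAt (fun ζ => 1 + conj z * ζ) (conj z) ζ := by
      simpa using ((hasDerivAt_id ζ).const_mul (conj z)).const_add 1
    have hφ' := (hasDerivAt_const ζ ((1 - ‖z‖ ^ 2 : ℝ) : ℂ)).div (hl.pow 2) (pow_ne_zero 2 hne)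
    rw [laplacian_comp_holomorphic
      (φ' := fun w => ((1 - ‖z‖ ^ 2 : ℝ) : ℂ) / (1 + conj z * w) ^ 2)
      (by filter_upwards [isOpen_ball.mem_nhds hζc] with w hw using hd w hw) hφ'
      (hh.contDiffAt (isOpen_ball.mem_nhds (hmap ζ hζc).2)), norm_smul, norm_pow, norm_norm,
      norm_div, norm_pow, Complex.norm_real, Real.norm_eq_abs, abs_of_pos hp]
    have hin : discMoebius z ζ ∈ ball (0 : ℂ) 1 := by
      rw [mem_ball_zero_iff] at hζ ⊢
      exact norm_discMoebius_lt_one hz hζ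
    calc _ ≤ ((1 - r ^ 2) / ‖1 + conj z * ζ‖ ^ 2) ^ 2 * N := by gcongr; exact hN _ hin
      _ = _ := by rw [div_pow, ← pow_mul]; ring
  -- `β'` is (1 - x²) times the circle integral of the Laplacian bound `hlap`, and `greenPrimitive`
  -- integrates it.
  set β : ℝ → ℝ := fun x => 2 * Real.pi * N * (1 - r ^ 2) ^ 2 * greenPrimitive r x with hβ
  set β' : ℝ → ℝ := fun x => 2 * Real.pi * N * (1 - r ^ 2) ^ 2 *
    ((1 - x ^ 2) * (1 + r ^ 2 * x ^ 2) / (1 - r ^ 2 * x ^ 2) ^ 3) with hβ'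
  have hrx : ∀ x ∈ Icc (0 : ℝ) 1, |r * x| < 1 := fun x hx => by
    rw [abs_of_nonneg (mul_nonneg hr0.le hx.1)]
    nlinarith [hx.1, hx.2]
  have main := norm_firstMode_sub_fderiv_le hc hC2 hξ (β := β) (β' := β')
    (fun x hx => (hasDerivAt_greenPrimitive hr0 (hrx x hx)).const_mul _) (fun x hx => ?_)
  -- The Möbius map has the positive derivative 1 - r² at 0, so the direction ξ is preserved.
  · have hf0 : fderiv ℝ (h ∘ discMoebius z) 0 ξ = (1 - r ^ 2) • fderiv ℝ h z ξ := by
      have h0c : (0 : ℂ) ∈ ball (0 : ℂ) c := by simpa using one_pos.trans hc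
      have hzb : z ∈ ball (0 : ℂ) b := by simpa using hz.trans hb
      have hd0 := hd 0 h0c
      rw [mul_zero, add_zero, one_pow, div_one] at hd0
      have h1 : HasFDerivAt h (fderiv ℝ h z) (discMoebius z 0) := by
        rw [discMoebius_zero]
        exact hasFDerivAt_of_contDiffOn_ball hh hzb
      rw [(h1.comp 0 (hd0.hasFDerivAt.restrictScalars ℝ)).fderiv, ← map_smul]
      simp [mul_comm, hr]
    have hfm : firstMode (h ∘ discMoebius z) ξ 1 = (1 - r ^ 2) •
        ∫ t in (0 : ℝ)..2 * Real.pi, gradKernel z ξ (circleMap 0 1 t) • h (circleMap 0 1 t) := by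
      rw [← integral_gradKernel_smul hz ξ
        (hh.continuousOn.mono fun w hw => by simp at hw; simp [hw, hb])]
      simp [firstMode]
    rw [hfm, hf0] at main
    have hβv : β 1 - β 0 = (2 * Real.pi) * (1 - r ^ 2) * (2 * muFun N r) := by
      simp only [hβ, greenPrimitive_zero, mul_zero, sub_zero]
      rw [muFun_eq_mul N r, mul_assoc _ _ (greenPrimitive r 1), greenPrimitive_one hr0 hz]
      ring
    rw [hβv] at main
    have hfac : ∀ I D : ℂ, (1 - r ^ 2) • I - (2 * Real.pi) • (1 - r ^ 2) • D
        = ((2 * Real.pi) * (1 - r ^ 2)) • ((2 * Real.pi)⁻¹ • I - D) := by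
      intro I D
      have : (2 * Real.pi) ≠ 0 := by positivity
      rw [smul_sub, smul_smul, smul_smul]
      congr 2
      field_simp
    have hpos : 0 < (2 * Real.pi) * (1 - r ^ 2) := by positivity
    rw [hfac, norm_smul, Real.norm_eq_abs, abs_of_pos hpos] at main
    exact le_of_mul_le_mul_left main hpos
  · have hx1 : 0 < 1 - x ^ 2 := by nlinarith [hx.1, hx.2]
    have hxe : ∀ t, (x : ℂ) * circleMap 0 1 t ∈ ball (0 : ℂ) 1 := fun t =>
      mul_circleMap_mem_ball (by rw [mem_ball_zero_iff, Real.norm_eq_abs, abs_of_pos hx.1]; exact hx.2) t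
    have hxr : ‖(x : ℂ) * z‖ = r * x := by
      rw [norm_mul, Complex.norm_real, Real.norm_eq_abs, abs_of_pos hx.1, mul_comm]
    have hxz : ‖(x : ℂ) * z‖ < 1 := by
      rw [hxr]; exact (abs_lt.1 (hrx x ⟨hx.1.le, hx.2.le⟩)).2
    -- The circle of radius x for z is the unit circle for xz.
    have e4 := integral_one_div_norm_pow_four hxz
    rw [hxr] at e4
    have hw : ∀ t : ℝ, conj ((x : ℂ) * z) * circleMap 0 1 t = conj z * (x * circleMap 0 1 t) := by
      intro t; rw [map_mul, Complex.conj_ofReal]; ring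
    simp_rw [hw] at e4
    have hcont : Continuous fun t : ℝ => 1 / ‖1 + conj z * (x * circleMap 0 1 t)‖ ^ 4 := by
      refine Continuous.div continuous_const (by fun_prop) fun t => ?_
      have := (hmap _ (ball_subset_ball hc.le (hxe t))).1
      simpa using this
    calc _ ≤ (1 - x ^ 2) * ∫ t in (0 : ℝ)..2 * Real.pi,
          N * (1 - r ^ 2) ^ 2 * (1 / ‖1 + conj z * (x * circleMap 0 1 t)‖ ^ 4) := by
          refine mul_le_mul_of_nonneg_left ?_ hx1.le
          refine intervalIntegral.integral_mono_on (by positivity) ?_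
            ((continuous_const.mul hcont).intervalIntegrable _ _) fun t _ => hlap _ (hxe t)
          refine Continuous.intervalIntegrable ?_ _ _
          exact (continuous_comp_mul_circleMap (continuousOn_laplacian_ball hC2) (by
            rw [mem_ball_zero_iff, Real.norm_eq_abs, abs_of_pos hx.1]; exact hx.2.trans hc)).norm
      _ = β' x := by
          rw [intervalIntegral.integral_const_mul, e4, hβ']
          dsimp only
          rw [mul_pow]
          ring

lemma circleMap_mem_ball {R : ℝ} (h0 : 0 < R) (h1 : R < 1) (t : ℝ) :
    circleMap 0 R t ∈ ball (0 : ℂ) 1 := by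
  simp [abs_of_pos h0, h1]

open MeasureTheory in
/-- Weighted circle means of `f` converge to those of its boundary values. -/
lemma tendsto_integral_smul_circleMap {f ψ : ℂ → ℂ} (hf : ContinuousOn f (ball 0 1))
    (hψ : CircleIntegrable ψ 0 1)
    (hlim : Tendsto (fun r : ℝ => ∫ t in (0 : ℝ)..(2 * Real.pi),
      ‖f (circleMap 0 r t) - ψ (circleMap 0 1 t)‖) (𝓝[<] 1) (𝓝 0))
    {K : ℝ → ℝ} (hK : Continuous K) :
    Tendsto (fun r : ℝ => ∫ t in (0 : ℝ)..2 * Real.pi, K t • f (circleMap 0 r t)) (𝓝[<] 1)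
      (𝓝 (∫ t in (0 : ℝ)..2 * Real.pi, K t • ψ (circleMap 0 1 t))) := by
  obtain ⟨C, hC⟩ := (isCompact_uIcc (a := 0) (b := 2 * Real.pi)).exists_bound_of_continuousOn
    hK.continuousOn
  rw [tendsto_iff_norm_sub_tendsto_zero]
  refine squeeze_zero' (Eventually.of_forall fun _ => norm_nonneg _) ?_
    (by simpa using hlim.const_mul C)
  filter_upwards [Ioo_mem_nhdsLT (zero_lt_one (α := ℝ))] with r hr
  have hfr : Continuous fun t => f (circleMap 0 r t) :=
    hf.comp_continuous (continuous_circleMap 0 r) (circleMap_mem_ball hr.1 hr.2)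
  have hi := hfr.intervalIntegrable (μ := volume) 0 (2 * Real.pi)
  have hψ' : IntervalIntegrable (fun t => ψ (circleMap 0 1 t)) volume 0 (2 * Real.pi) := hψ
  have hKf : Continuous fun t => K t • f (circleMap 0 r t) := hK.smul hfr
  rw [← intervalIntegral.integral_sub (hKf.intervalIntegrable _ _)
    (hψ'.continuousOn_smul hK.continuousOn), ← intervalIntegral.integral_const_mul]
  refine intervalIntegral.norm_integral_le_of_norm_le (by positivity)
    (Eventually.of_forall fun t ht => ?_) ((hi.sub hψ').norm.const_mul C)
  rw [← smul_sub, norm_smul]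
  gcongr
  exact hC t (uIoc_subset_uIcc (by rwa [uIoc_of_le (by positivity)]))

lemma continuous_poissonKernel_circleMap {w : ℂ} (hw : ‖w‖ < 1) :
    Continuous fun t : ℝ => poissonKernel 0 w (circleMap 0 1 t) := by
  simp only [poissonKernel_def, sub_zero]
  refine Continuous.div (by fun_prop) (by fun_prop) fun t h => ?_
  have h1 : circleMap 0 1 t = w := by simpa [sub_eq_zero] using h
  have h2 : ‖circleMap 0 1 t‖ = 1 := by simp
  rw [h1] at h2
  exact hw.ne h2

lemma poissonKernel_mul_circleMap_comm (R s t : ℝ) :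
    poissonKernel 0 (R * circleMap 0 1 s) (circleMap 0 1 t)
      = poissonKernel 0 (R * circleMap 0 1 t) (circleMap 0 1 s) := by
  have hs : ‖circleMap 0 1 s‖ = 1 := by simp
  have ht : ‖circleMap 0 1 t‖ = 1 := by simp
  simp only [poissonKernel_def, sub_zero, norm_mul, hs, ht]
  congr 1
  simp only [← Complex.normSq_eq_norm_sq]
  rw [Complex.normSq_sub, Complex.normSq_sub]
  simp only [Complex.normSq_eq_norm_sq, norm_mul, hs, ht]
  simp
  ring

/-- The kernel is the real part of a function holomorphic near the closed disc, so it is reproduced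
by the Poisson kernel. -/
lemma gradKernel_poisson {z ξ w : ℂ} (hz : ‖z‖ < 1) (hw : ‖w‖ < 1) :
    ∫ t in (0 : ℝ)..2 * Real.pi,
      poissonKernel 0 w (circleMap 0 1 t) * gradKernel z ξ (circleMap 0 1 t)
      = 2 * Real.pi * gradKernel z ξ w := by
  have hh : InnerProductSpace.HarmonicOnNhd (gradKernel z ξ) (closedBall 0 1) := by
    intro η hη
    have hne := one_sub_conj_mul_ne_zero hz (by simpa using hη : ‖η‖ ≤ 1)
    have : AnalyticAt ℂ (fun η => 2 * (conj ξ * η / (1 - conj z * η) ^ 2)) η := by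
      fun_prop (disch := exact pow_ne_zero 2 hne)
    have e : gradKernel z ξ = fun η => (2 * (conj ξ * η / (1 - conj z * η) ^ 2)).re := by
      ext η; simp [gradKernel]
    rw [e]
    exact this.harmonicAt_re
  have := InnerProductSpace.HarmonicOnNhd.circleAverage_poissonKernel_smul hh
    (by simpa using hw : w ∈ ball (0 : ℂ) 1)
  rw [Real.circleAverage_def, smul_eq_mul, inv_mul_eq_iff_eq_mul₀ (by positivity)] at this
  rw [← this]
  simp

open MeasureTheory in
lemma integral_integral_smul_swap {K : ℝ → ℝ → ℝ} (hK : Continuous fun p : ℝ × ℝ => K p.1 p.2)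
    {v : ℝ → ℂ} {a b : ℝ} (hv : IntervalIntegrable v volume a b) :
    ∫ s in a..b, ∫ t in a..b, K s t • v t = ∫ t in a..b, (∫ s in a..b, K s t) • v t := by
  rw [intervalIntegral_intervalIntegral_swap]
  · simp_rw [intervalIntegral.integral_smul_const]
  · obtain ⟨C, hC⟩ := ((isCompact_uIcc (a := a) (b := b)).prod
      (isCompact_uIcc (a := a) (b := b))).exists_bound_of_continuousOn hK.continuousOn
    rw [IntegrableOn, Measure.volume_eq_prod, ← Measure.prod_restrict]
    have : IsFiniteMeasure (volume.restrict (uIoc a b)) :=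
      inferInstanceAs (IsFiniteMeasure (volume.restrict (Ioc _ _)))
    have hv' : Integrable (fun p : ℝ × ℝ => v p.2)
        ((volume.restrict (uIoc a b)).prod (volume.restrict (uIoc a b))) :=
      (intervalIntegrable_iff.1 hv).comp_snd _
    refine hv'.bdd_smul C hK.aestronglyMeasurable ?_
    rw [Measure.prod_restrict, ae_restrict_iff' (measurableSet_uIoc.prod measurableSet_uIoc)]
    exact Eventually.of_forall fun p hp => hC p ⟨uIoc_subset_uIcc hp.1, uIoc_subset_uIcc hp.2⟩

open MeasureTheory in
-- The dilated kernel is the Poisson integral of the kernel. Fubini and the symmetry of the Poisson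
-- kernel move the smoothing onto ψ.
lemma integral_gradKernel_mul_smul {ψ : ℂ → ℂ} (hψ : CircleIntegrable ψ 0 1) {z ξ : ℂ}
    (hz : ‖z‖ < 1) {R : ℝ} (h0 : 0 < R) (h1 : R < 1) :
    ∫ t in (0 : ℝ)..2 * Real.pi, gradKernel z ξ (R * circleMap 0 1 t) • ψ (circleMap 0 1 t)
      = ∫ s in (0 : ℝ)..2 * Real.pi,
        gradKernel z ξ (circleMap 0 1 s) • poissonIntegral ψ (R * circleMap 0 1 s) := by
  have hRe : ∀ t, ‖(R : ℂ) * circleMap 0 1 t‖ < 1 := fun t => by simpa [abs_of_pos h0] using h1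
  have hk : Continuous fun t => gradKernel z ξ (circleMap 0 1 t) :=
    (continuousOn_gradKernel hz ξ).comp_continuous (continuous_circleMap 0 1) fun t => by simp
  have hP : Continuous fun p : ℝ × ℝ =>
      poissonKernel 0 (R * circleMap 0 1 p.1) (circleMap 0 1 p.2) := by
    simp only [poissonKernel_def, sub_zero]
    refine Continuous.div (by fun_prop) (by fun_prop) fun p h => ?_
    have e1 : circleMap 0 1 p.2 = R * circleMap 0 1 p.1 := by simpa [sub_eq_zero] using h
    have e2 : ‖circleMap 0 1 p.2‖ = 1 := by simp
    rw [e1] at e2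
    exact (hRe p.1).ne e2
  have hK : Continuous fun p : ℝ × ℝ => (2 * Real.pi)⁻¹ * (gradKernel z ξ (circleMap 0 1 p.1) *
      poissonKernel 0 (R * circleMap 0 1 p.1) (circleMap 0 1 p.2)) :=
    continuous_const.mul ((hk.comp continuous_fst).mul hP)
  have hsw := integral_integral_smul_swap (a := 0) (b := 2 * Real.pi) (K := fun s t =>
    (2 * Real.pi)⁻¹ * (gradKernel z ξ (circleMap 0 1 s) *
      poissonKernel 0 (R * circleMap 0 1 s) (circleMap 0 1 t))) hK
    (v := fun t => ψ (circleMap 0 1 t)) hψ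
  have hl : ∀ s : ℝ, gradKernel z ξ (circleMap 0 1 s) • poissonIntegral ψ (R * circleMap 0 1 s)
      = ∫ t in (0 : ℝ)..2 * Real.pi, ((2 * Real.pi)⁻¹ * (gradKernel z ξ (circleMap 0 1 s) *
      poissonKernel 0 (R * circleMap 0 1 s) (circleMap 0 1 t))) • ψ (circleMap 0 1 t) := by
    intro s
    rw [poissonIntegral, Real.circleAverage_def, ← intervalIntegral.integral_smul,
      ← intervalIntegral.integral_smul]
    refine intervalIntegral.integral_congr fun t _ => ?_
    simp only [smul_smul]
    congr 1
    ring
  have hr : ∀ t : ℝ, ∫ s in (0 : ℝ)..2 * Real.pi, ((2 * Real.pi)⁻¹ *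
      (gradKernel z ξ (circleMap 0 1 s) *
        poissonKernel 0 (R * circleMap 0 1 s) (circleMap 0 1 t)))
      = gradKernel z ξ (R * circleMap 0 1 t) := by
    intro t
    rw [intervalIntegral.integral_const_mul, inv_mul_eq_iff_eq_mul₀ (by positivity),
      ← gradKernel_poisson hz (hRe t)]
    refine intervalIntegral.integral_congr fun s _ => ?_
    simp only [poissonKernel_mul_circleMap_comm R s t]
    ring
  simp_rw [hl]
  rw [hsw]
  simp_rw [hr]

open MeasureTheory in
-- For each R < 1 the dilated integral only sees P_ψ inside the disc, hence the bound; dominated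
-- convergence gives R → 1. No boundary limits of P_ψ are involved.
lemma norm_integral_gradKernel_smul_le {ψ : ℂ → ℂ} (hψ : CircleIntegrable ψ 0 1)
    (hP : discSup (poissonIntegral ψ) ≠ ∞) {z ξ : ℂ} (hz : ‖z‖ < 1) (hξ : ‖ξ‖ = 1) :
    ‖∫ t in (0 : ℝ)..2 * Real.pi, gradKernel z ξ (circleMap 0 1 t) • ψ (circleMap 0 1 t)‖
      ≤ 8 / (1 - ‖z‖ ^ 2) * (discSup (poissonIntegral ψ)).toReal := by
  have hψ' : IntervalIntegrable (fun t => ψ (circleMap 0 1 t)) volume 0 (2 * Real.pi) := hψ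
  have hkc := continuousOn_gradKernel hz ξ
  obtain ⟨C, hC⟩ := (isCompact_closedBall (0 : ℂ) 1).exists_bound_of_continuousOn hkc
  have hk : Continuous fun t => gradKernel z ξ (circleMap 0 1 t) :=
    hkc.comp_continuous (continuous_circleMap 0 1) fun t => by simp
  have hmem : ∀ R ∈ Ioo (0 : ℝ) 1, ∀ t, (R : ℂ) * circleMap 0 1 t ∈ ball (0 : ℂ) 1 :=
    fun R hR t => by simpa [abs_of_pos hR.1] using hR.2
  have hIoo := Ioo_mem_nhdsLT (zero_lt_one (α := ℝ))
  have hlim : Tendsto (fun R : ℝ => ∫ t in (0 : ℝ)..2 * Real.pi,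
      gradKernel z ξ (R * circleMap 0 1 t) • ψ (circleMap 0 1 t)) (𝓝[<] 1)
      (𝓝 (∫ t in (0 : ℝ)..2 * Real.pi, gradKernel z ξ (circleMap 0 1 t) • ψ (circleMap 0 1 t))) := by
    refine intervalIntegral.tendsto_integral_filter_of_dominated_convergence
      (fun t => C * ‖ψ (circleMap 0 1 t)‖) ?_ ?_ (hψ'.norm.const_mul C) ?_
    · filter_upwards [hIoo] with R hR
      have : Continuous fun t : ℝ => gradKernel z ξ (R * circleMap 0 1 t) :=
        hkc.comp_continuous (by fun_prop) fun t => ball_subset_closedBall (hmem R hR t)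
      exact this.aestronglyMeasurable.smul (intervalIntegrable_iff.1 hψ').aestronglyMeasurable
    · filter_upwards [hIoo] with R hR
      refine Eventually.of_forall fun t _ => ?_
      rw [norm_smul]
      gcongr
      exact hC _ (ball_subset_closedBall (hmem R hR t))
    · refine Eventually.of_forall fun t _ => Tendsto.smul_const ?_ _
      have h1 : ContinuousWithinAt (gradKernel z ξ) (closedBall 0 1) (circleMap 0 1 t) :=
        hkc _ (by simp)
      refine h1.tendsto.comp (tendsto_nhdsWithin_iff.2 ⟨?_, ?_⟩)
      · have : Continuous fun R : ℝ => (R : ℂ) * circleMap 0 1 t := by fun_prop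
        exact (this.tendsto' 1 _ (by simp)).mono_left nhdsWithin_le_nhds
      · filter_upwards [hIoo] with R hR using ball_subset_closedBall (hmem R hR t)
  refine le_of_tendsto hlim.norm ?_
  filter_upwards [hIoo] with R hR
  rw [integral_gradKernel_mul_smul hψ hz hR.1 hR.2, ← integral_abs_gradKernel hz hξ,
    ← intervalIntegral.integral_mul_const]
  refine intervalIntegral.norm_integral_le_of_norm_le (by positivity)
    (Eventually.of_forall fun t _ => ?_) ((hk.abs.mul continuous_const).intervalIntegrable _ _)
  rw [norm_smul, Real.norm_eq_abs]
  gcongr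
  exact norm_le_toReal_discSup hP (hmem R hR t)

lemma contDiffOn_comp_ofReal_mul {f : ℂ → ℂ} (hf : ContDiffOn ℝ 2 f (ball 0 1)) {R : ℝ}
    (h0 : 0 < R) : ContDiffOn ℝ 2 (fun w => f (R * w)) (ball 0 (1 / R)) := by
  refine hf.comp (t := ball 0 1) (by fun_prop) fun w hw => ?_
  rw [mem_ball_zero_iff, lt_div_iff₀ h0] at hw
  simpa [abs_of_pos h0, mul_comm] using hw

lemma laplacian_comp_ofReal_mul {f : ℂ → ℂ} (hf : ContDiffOn ℝ 2 f (ball 0 1)) {R : ℝ} {w : ℂ}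
    (hw : (R : ℂ) * w ∈ ball (0 : ℂ) 1) :
    Laplacian.laplacian (fun w => f (R * w)) w = R ^ 2 • Laplacian.laplacian f (R * w) := by
  have := laplacian_comp_holomorphic (h := f) (φ := fun w : ℂ => (R : ℂ) * w)
    (φ' := fun _ => (R : ℂ)) (ζ := w) (φ'' := 0)
    (Eventually.of_forall fun w => by simpa using (hasDerivAt_id w).const_mul (R : ℂ))
    (hasDerivAt_const _ _) (hf.contDiffAt (isOpen_ball.mem_nhds hw))
  rw [Complex.norm_real, Real.norm_eq_abs, sq_abs] at this
  exact this

lemma fderiv_comp_ofReal_mul {f : ℂ → ℂ} (hf : ContDiffOn ℝ 2 f (ball 0 1)) {R : ℝ} {w : ℂ}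
    (hw : (R : ℂ) * w ∈ ball (0 : ℂ) 1) (ξ : ℂ) :
    fderiv ℝ (fun w => f (R * w)) w ξ = fderiv ℝ f (R * w) (R * ξ) := by
  have h1 : HasDerivAt (fun w : ℂ => (R : ℂ) * w) (R : ℂ) w := by
    simpa using (hasDerivAt_id w).const_mul (R : ℂ)
  have := ((hasFDerivAt_of_contDiffOn_ball hf hw).comp w (h1.hasFDerivAt.restrictScalars ℝ)).fderiv
  have e : (fun w => f (R * w)) = f ∘ fun w : ℂ => (R : ℂ) * w := rfl
  rw [e, this]
  simp [mul_comm]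

theorem norm_fderiv_le_of_isPoissonSolution {f g ψ : ℂ → ℂ} (h : IsPoissonSolution f g ψ)
    (hP : discSup (poissonIntegral ψ) ≠ ∞) {z : ℂ} (hz : ‖z‖ < 1) (hz0 : z ≠ 0) :
    ‖fderiv ℝ f z‖ ≤ 4 / Real.pi * (1 / (1 - ‖z‖ ^ 2)) * (discSup (poissonIntegral ψ)).toReal
      + 2 * muFun (discSup g).toReal ‖z‖ := by
  have hp := one_sub_sq_norm_pos hz
  have hg := discSup_ne_top_of_continuousOn h.continuousOn_rhs
  set N := (discSup g).toReal with hN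
  have hN0 : 0 ≤ N := ENNReal.toReal_nonneg
  have hμ : 0 ≤ muFun N ‖z‖ := by
    have hr : ‖z‖ ∈ Ioo (0 : ℝ) 1 := ⟨norm_pos_iff.2 hz0, hz⟩
    rw [muFun_eq_mul]
    exact mul_nonneg hN0 (le_trans (by nlinarith [hr.1, hr.2]) (le_muFun_one hr))
  refine ContinuousLinearMap.opNorm_le_of_unit_norm (by positivity) fun ξ hξ => ?_
  have hk : Continuous fun t => gradKernel z ξ (circleMap 0 1 t) :=
    (continuousOn_gradKernel hz ξ).comp_continuous (continuous_circleMap 0 1) fun t => by simp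
  have hl1 := tendsto_integral_smul_circleMap h.contDiffOn.continuousOn h.integrable_boundary
    h.tendsto_boundary hk
  have hl2 : Tendsto (fun R : ℝ => fderiv ℝ f (R * z) (R * ξ)) (𝓝[<] 1) (𝓝 (fderiv ℝ f z ξ)) := by
    have hc : ContinuousAt (fderiv ℝ f) z := (continuousOn_fderiv_ball h.contDiffOn).continuousAt
      (isOpen_ball.mem_nhds (by simpa using hz))
    have h1 : ContinuousAt (fun R : ℝ => fderiv ℝ f (R * z)) 1 :=
      ContinuousAt.comp (g := fderiv ℝ f) (f := fun R : ℝ => (R : ℂ) * z) (by simpa using hc)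
        (by fun_prop)
    have h2 : ContinuousAt (fun R : ℝ => fderiv ℝ f (R * z) (R * ξ)) 1 :=
      h1.clm_apply (by fun_prop)
    simpa using h2.tendsto.mono_left (nhdsWithin_le_nhds (s := Iio 1))
  have key : ‖(2 * Real.pi)⁻¹ • (∫ t in (0 : ℝ)..2 * Real.pi,
      gradKernel z ξ (circleMap 0 1 t) • ψ (circleMap 0 1 t)) - fderiv ℝ f z ξ‖
      ≤ 2 * muFun N ‖z‖ := by
    -- The estimate is applied to f(R·), which is C² on the disc of radius 1/R > 1 with Laplacian R²
    -- g(R·), still bounded by `N`.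
    refine le_of_tendsto ((hl1.const_smul ((2 * Real.pi)⁻¹)).sub hl2).norm ?_
    filter_upwards [Ioo_mem_nhdsLT (zero_lt_one (α := ℝ))] with R hR
    have hRw : ∀ w ∈ ball (0 : ℂ) 1, (R : ℂ) * w ∈ ball (0 : ℂ) 1 := fun w hw => by
      rw [mem_ball_zero_iff] at hw ⊢
      rw [norm_mul, Complex.norm_real, Real.norm_eq_abs, abs_of_pos hR.1]
      nlinarith [norm_nonneg w, hR.2]
    have := norm_integral_gradKernel_sub_fderiv_le (h := fun w => f (R * w)) (b := 1 / R) (N := N)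
      (by rw [lt_div_iff₀ hR.1]; linarith [hR.2]) (contDiffOn_comp_ofReal_mul h.contDiffOn hR.1)
      (fun w hw => ?_) hz0 hz hξ
    · rw [fderiv_comp_ofReal_mul h.contDiffOn (hRw z (by simpa using hz))] at this
      simpa [circleMap] using this
    · rw [laplacian_comp_ofReal_mul h.contDiffOn (hRw w hw), h.laplacian_eq _ (hRw w hw), norm_smul,
        Real.norm_eq_abs, abs_of_nonneg (sq_nonneg R)]
      have := norm_le_toReal_discSup hg (hRw w hw)
      have hR2 : R ^ 2 ≤ 1 := by nlinarith [hR.1, hR.2]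
      calc R ^ 2 * ‖g (R * w)‖ ≤ 1 * N := by gcongr
        _ = N := one_mul N
  have hI := norm_integral_gradKernel_smul_le h.integrable_boundary hP hz hξ
  set I := ∫ t in (0 : ℝ)..2 * Real.pi, gradKernel z ξ (circleMap 0 1 t) • ψ (circleMap 0 1 t)
  have h2 : ‖(2 * Real.pi)⁻¹ • I‖
      ≤ 4 / Real.pi * (1 / (1 - ‖z‖ ^ 2)) * (discSup (poissonIntegral ψ)).toReal := by
    rw [norm_smul, Real.norm_eq_abs, abs_of_pos (by positivity : (0 : ℝ) < (2 * Real.pi)⁻¹)]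
    calc _ ≤ (2 * Real.pi)⁻¹ * (8 / (1 - ‖z‖ ^ 2) * (discSup (poissonIntegral ψ)).toReal) := by
          gcongr
      _ = _ := by field_simp; ring
  calc ‖fderiv ℝ f z ξ‖ = ‖(2 * Real.pi)⁻¹ • I - ((2 * Real.pi)⁻¹ • I - fderiv ℝ f z ξ)‖ := by
        rw [sub_sub_cancel]
    _ ≤ ‖(2 * Real.pi)⁻¹ • I‖ + ‖(2 * Real.pi)⁻¹ • I - fderiv ℝ f z ξ‖ := norm_sub_le _ _
    _ ≤ _ := add_le_add h2 key

theorem enorm_fderiv_le_gradBound {f g ψ : ℂ → ℂ} (h : IsPoissonSolution f g ψ) {z : ℂ}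
    (hz : z ∈ ball (0 : ℂ) 1) (hz0 : z ≠ 0) :
    ‖fderiv ℝ f z‖ₑ ≤ gradBound (discSup (poissonIntegral ψ)) (discSup g).toReal ‖z‖ := by
  have hz1 : ‖z‖ < 1 := by simpa using hz
  have hp := one_sub_sq_norm_pos hz1
  have hcoef : 0 < 4 / Real.pi * (1 / (1 - ‖z‖ ^ 2)) := by positivity
  by_cases hP : discSup (poissonIntegral ψ) = ∞
  · rw [hP, gradBound, ENNReal.mul_top (by simpa using hcoef), top_add]
    exact le_top
  · have := norm_fderiv_le_of_isPoissonSolution h hP hz1 hz0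
    rw [← ofReal_norm]
    refine (ENNReal.ofReal_le_ofReal this).trans (ENNReal.ofReal_add_le.trans ?_)
    rw [gradBound, ENNReal.ofReal_mul hcoef.le, ENNReal.ofReal_toReal hP]

theorem enorm_fderiv_zero_le_gradBoundZero {f g ψ : ℂ → ℂ} (h : IsPoissonSolution f g ψ) :
    ‖fderiv ℝ f 0‖ₑ ≤ gradBoundZero (discSup (poissonIntegral ψ)) (discSup g).toReal := by
  have hc : ContinuousAt (fderiv ℝ f) 0 := (continuousOn_fderiv_ball h.contDiffOn).continuousAt
    (isOpen_ball.mem_nhds (by simp))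
  have hl : Tendsto (fun z => ‖fderiv ℝ f z‖ₑ) (𝓝[≠] 0) (𝓝 ‖fderiv ℝ f 0‖ₑ) :=
    (hc.enorm.tendsto).mono_left nhdsWithin_le_nhds
  refine le_of_tendsto_of_tendsto hl (tendsto_gradBound _ _) ?_
  filter_upwards [self_mem_nhdsWithin, nhdsWithin_le_nhds (ball_mem_nhds (0 : ℂ) one_pos)] with z h0 hz
  exact enorm_fderiv_le_gradBound h hz h0

end Gradient

/-! ### Disc automorphisms and the extremal functions -/

section Sharpness

open ComplexConjugate

lemma differentiableOn_discMoebius {a : ℂ} (ha : ‖a‖ < 1) :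
    DifferentiableOn ℂ (discMoebius a) (ball 0 1) := fun _ hζ =>
  (hasDerivAt_discMoebius (one_add_conj_mul_ne_zero ha
    (mem_ball_zero_iff.1 hζ).le)).differentiableAt.differentiableWithinAt

lemma mapsTo_discMoebius {a : ℂ} (ha : ‖a‖ < 1) :
    MapsTo (discMoebius a) (ball 0 1) (ball 0 1) := fun _ hζ =>
  mem_ball_zero_iff.2 (norm_discMoebius_lt_one ha (mem_ball_zero_iff.1 hζ))

lemma discMoebius_neg_discMoebius_of_norm_le {a ζ : ℂ} (ha : ‖a‖ < 1) (hζ : ‖ζ‖ ≤ 1) :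
    discMoebius (-a) (discMoebius a ζ) = ζ :=
  discMoebius_neg_discMoebius ha (one_add_conj_mul_ne_zero ha hζ)

lemma discMoebius_discMoebius_neg_of_norm_le {a ζ : ℂ} (ha : ‖a‖ < 1) (hζ : ‖ζ‖ ≤ 1) :
    discMoebius a (discMoebius (-a) ζ) = ζ := by
  simpa using discMoebius_neg_discMoebius_of_norm_le (a := -a) (by simpa using ha) hζ

lemma isDiscAutomorphism_discMoebius {a : ℂ} (ha : ‖a‖ < 1) :
    IsDiscAutomorphism (discMoebius a) := by
  have ha' : ‖-a‖ < 1 := by simpa using ha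
  exact ⟨differentiableOn_discMoebius ha, mapsTo_discMoebius ha, discMoebius (-a),
    differentiableOn_discMoebius ha', mapsTo_discMoebius ha',
    fun ζ hζ => discMoebius_neg_discMoebius_of_norm_le ha (mem_ball_zero_iff.1 hζ).le,
    fun ζ hζ => discMoebius_discMoebius_neg_of_norm_le ha (mem_ball_zero_iff.1 hζ).le⟩

/-- Every conformal automorphism of the disc is a Möbius transformation followed by a rotation. -/
theorem IsDiscAutomorphism.exists_eqOn {φ : ℂ → ℂ} (h : IsDiscAutomorphism φ) :
    ∃ a c : ℂ, ‖a‖ < 1 ∧ ‖c‖ = 1 ∧ EqOn φ (fun w => c * discMoebius a w) (ball 0 1) := by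
  obtain ⟨hφ, hφm, χ, hχ, hχm, hinv⟩ := h
  have h0 : (0 : ℂ) ∈ ball (0 : ℂ) 1 := by simp
  have hp : ‖χ 0‖ < 1 := mem_ball_zero_iff.1 (hχm h0)
  set p := χ 0 with hpdef
  have hp' : ‖-p‖ < 1 := by simpa using hp
  have hφp : φ p = 0 := hinv.2 h0
  -- This map and its inverse `discMoebius (-p) ∘ χ` both fix 0. The Schwarz lemma for both makes it
  -- norm preserving, and the equality case makes it a rotation.
  have hG : DifferentiableOn ℂ (φ ∘ discMoebius p) (ball 0 1) :=
    hφ.comp (differentiableOn_discMoebius hp) (mapsTo_discMoebius hp)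
  have hGm : MapsTo (φ ∘ discMoebius p) (ball 0 1) (ball 0 1) := hφm.comp (mapsTo_discMoebius hp)
  have hG0 : (φ ∘ discMoebius p) 0 = 0 := by simp [discMoebius_zero, hφp]
  have hK : DifferentiableOn ℂ (discMoebius (-p) ∘ χ) (ball 0 1) :=
    (differentiableOn_discMoebius hp').comp hχ hχm
  have hKm : MapsTo (discMoebius (-p) ∘ χ) (ball 0 1) (ball 0 1) :=
    (mapsTo_discMoebius hp').comp hχm
  have hK0 : (discMoebius (-p) ∘ χ) 0 = 0 := by
    simp [← hpdef, discMoebius]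
  have hnorm : ∀ w ∈ ball (0 : ℂ) 1, ‖(φ ∘ discMoebius p) w‖ = ‖w‖ := by
    intro w hw
    refine le_antisymm (Complex.norm_le_norm_of_mapsTo_ball hG
      (hGm.mono_right ball_subset_closedBall) hG0 (mem_ball_zero_iff.1 hw)) ?_
    have := Complex.norm_le_norm_of_mapsTo_ball hK
      (hKm.mono_right ball_subset_closedBall) hK0 (mem_ball_zero_iff.1 (hGm hw))
    have e : (discMoebius (-p) ∘ χ) ((φ ∘ discMoebius p) w) = w := by
      simp only [Function.comp_apply]
      rw [hinv.1 (mapsTo_discMoebius hp hw)]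
      exact discMoebius_neg_discMoebius_of_norm_le hp (mem_ball_zero_iff.1 hw).le
    rwa [e] at this
  obtain ⟨C, hC, hEq⟩ := Complex.affine_of_mapsTo_ball_of_exists_norm_dslope_eq_div' (R₂ := 1) hG
    (by rw [hG0]; exact hGm.mono_right ball_subset_closedBall)
    -- Any nonzero point of the disc would serve.
    ⟨1 / 2, by simp; norm_num, by
      rw [dslope_of_ne _ (by norm_num : (1 / 2 : ℂ) ≠ 0), slope_def_module, hG0, sub_zero, sub_zero,
        norm_smul, hnorm _ (by simp; norm_num)]
      norm_num⟩
  refine ⟨-p, C, hp', by simpa using hC, fun w hw => ?_⟩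
  have := hEq (mapsTo_discMoebius hp' hw)
  rw [hG0] at this
  simp only [Function.comp_apply, zero_add, sub_zero, smul_eq_mul] at this
  rw [discMoebius_discMoebius_neg_of_norm_le hp (mem_ball_zero_iff.1 hw).le] at this
  rw [this, mul_comm]

lemma one_add_div_one_sub_re_pos {w : ℂ} (hw : ‖w‖ < 1) : 0 < ((1 + w) / (1 - w)).re := by
  have hne : 1 - w ≠ 0 := fun h => by
    rw [← sub_eq_zero.1 h, norm_one] at hw; exact lt_irrefl _ hw
  have hn : 0 < Complex.normSq (1 - w) := Complex.normSq_pos.2 hne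
  have h1 : Complex.normSq w < 1 := by
    rw [Complex.normSq_eq_norm_sq]; nlinarith [norm_nonneg w]
  rw [Complex.normSq_apply] at h1
  rw [Complex.div_re, ← add_div]
  refine div_pos ?_ hn
  simp
  nlinarith

lemma one_add_div_one_sub_mem_slitPlane {w : ℂ} (hw : ‖w‖ = 1) (h1 : w ≠ 1) (h2 : w ≠ -1) :
    (1 + w) / (1 - w) ∈ Complex.slitPlane := by
  have hne : 1 - w ≠ 0 := sub_ne_zero.2 h1.symm
  have hn : Complex.normSq (1 - w) ≠ 0 := by simpa using hne
  have hq : w.re * w.re + w.im * w.im = 1 := by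
    rw [← Complex.normSq_apply, Complex.normSq_eq_norm_sq, hw, one_pow]
  refine Or.inr ?_
  rw [Complex.div_im, ← sub_div]
  refine div_ne_zero ?_ hn
  have him : w.im ≠ 0 := by
    intro h0
    rw [h0] at hq
    have : (w.re - 1) * (w.re + 1) = 0 := by linear_combination hq
    rcases mul_eq_zero.1 this with h | h
    · exact h1 (Complex.ext (by simp; linarith) (by simp [h0]))
    · exact h2 (Complex.ext (by simp; linarith) (by simp [h0]))
  have e : (1 + w).im * (1 - w).re - (1 + w).re * (1 - w).im = 2 * w.im := by simp; ring
  rw [e]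
  exact mul_ne_zero two_ne_zero him

lemma abs_arg_one_add_div_one_sub_lt {w : ℂ} (hw : ‖w‖ < 1) :
    |Complex.arg ((1 + w) / (1 - w))| < Real.pi / 2 :=
  Complex.abs_arg_lt_pi_div_two_iff.2 (Or.inl (one_add_div_one_sub_re_pos hw))

lemma hasDerivAt_log_one_add_div_one_sub {φ : ℂ → ℂ} {φ' z : ℂ} (hφ : HasDerivAt φ φ' z)
    (hz : ‖φ z‖ < 1) :
    HasDerivAt (fun z => Complex.log ((1 + φ z) / (1 - φ z))) (2 * φ' / (1 - φ z ^ 2)) z := by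
  have hre := one_add_div_one_sub_re_pos hz
  have hn : 1 - φ z ≠ 0 := by
    intro h; rw [h] at hre; simp at hre
  have hd : 1 + φ z ≠ 0 := by
    intro h; rw [h] at hre; simp at hre
  have hs : 1 - φ z ^ 2 ≠ 0 := by
    have : 1 - φ z ^ 2 = (1 - φ z) * (1 + φ z) := by ring
    rw [this]; exact mul_ne_zero hn hd
  refine (((hφ.const_add 1).div (hφ.const_sub 1) hn).clog (Or.inl hre)).congr_deriv ?_
  simp only [Pi.div_apply]
  field_simp
  ring

lemma norm_toSpanSingleton_comp_im_comp_mul (κ l : ℂ) :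
    ‖(ContinuousLinearMap.toSpanSingleton ℝ κ).comp
      (Complex.imCLM.comp (ContinuousLinearMap.mul ℝ ℂ l))‖ = ‖κ‖ * ‖l‖ := by
  refine le_antisymm (ContinuousLinearMap.opNorm_le_bound _ (by positivity) fun ξ => ?_) ?_
  · simp only [ContinuousLinearMap.comp_apply, ContinuousLinearMap.toSpanSingleton_apply,
      Complex.imCLM_apply, ContinuousLinearMap.mul_apply', norm_smul, Real.norm_eq_abs]
    calc |(l * ξ).im| * ‖κ‖ ≤ ‖l * ξ‖ * ‖κ‖ := by gcongr; exact Complex.abs_im_le_norm _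
      _ = ‖κ‖ * ‖l‖ * ‖ξ‖ := by rw [norm_mul]; ring
  · rcases eq_or_ne l 0 with rfl | hl
    · simp
    -- The norm is attained in the direction conj l · I, which l rotates onto the imaginary axis.
    have h := ContinuousLinearMap.le_opNorm ((ContinuousLinearMap.toSpanSingleton ℝ κ).comp
      (Complex.imCLM.comp (ContinuousLinearMap.mul ℝ ℂ l))) (conj l * Complex.I)
    have e : l * (conj l * Complex.I) = ((‖l‖ ^ 2 : ℝ) : ℂ) * Complex.I := by
      rw [← mul_assoc, Complex.mul_conj']; push_cast; rfl
    simp only [ContinuousLinearMap.comp_apply, ContinuousLinearMap.toSpanSingleton_apply,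
      Complex.imCLM_apply, ContinuousLinearMap.mul_apply', norm_smul, Real.norm_eq_abs, e,
      norm_mul, Complex.norm_I, mul_one, RCLike.norm_conj, Complex.im_ofReal_mul, Complex.I_im,
      abs_of_nonneg (sq_nonneg ‖l‖)] at h
    have hl0 : 0 < ‖l‖ := norm_pos_iff.2 hl
    refine le_of_mul_le_mul_right ?_ hl0
    calc ‖κ‖ * ‖l‖ * ‖l‖ = ‖l‖ ^ 2 * ‖κ‖ := by ring
      _ ≤ _ := h

lemma extremalFun_eq_smul (M : ℝ) (α : ℂ) (φ : ℂ → ℂ) (z : ℂ) :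
    extremalFun M α φ z
      = Complex.arg ((1 + φ z) / (1 - φ z)) • (2 * (M : ℂ) * α / (Real.pi : ℂ)) := by
  rw [extremalFun, Complex.real_smul, mul_comm]

lemma norm_extremalFun {M : ℝ} (hM : 0 < M) {α : ℂ} (hα : ‖α‖ = 1) (φ : ℂ → ℂ) (z : ℂ) :
    ‖extremalFun M α φ z‖ = 2 * M / Real.pi * |Complex.arg ((1 + φ z) / (1 - φ z))| := by
  simp [extremalFun, hα, abs_of_pos hM, abs_of_pos Real.pi_pos]

lemma extremalFun_congr {M : ℝ} {α : ℂ} {φ φ₁ : ℂ → ℂ} {s : Set ℂ} (h : EqOn φ φ₁ s) :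
    EqOn (extremalFun M α φ) (extremalFun M α φ₁) s := fun z hz => by
  simp only [extremalFun, h hz]

/-- The norm of the derivative of `extremalFun`. -/
lemma norm_fderiv_extremalFun {M : ℝ} (hM : 0 < M) {α : ℂ} (hα : ‖α‖ = 1) {φ : ℂ → ℂ} {φ' z : ℂ}
    (hφ : HasDerivAt φ φ' z) (hz : ‖φ z‖ < 1) :
    ‖fderiv ℝ (extremalFun M α φ) z‖ = 2 * M / Real.pi * ‖2 * φ' / (1 - φ z ^ 2)‖ := by
  have h1 := (hasDerivAt_log_one_add_div_one_sub hφ hz).hasFDerivAt.restrictScalars ℝ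
  have h2 := (ContinuousLinearMap.toSpanSingleton ℝ (2 * (M : ℂ) * α / (Real.pi : ℂ))).hasFDerivAt.comp z
    (Complex.imCLM.hasFDerivAt.comp z h1)
  have h3 : HasFDerivAt (extremalFun M α φ)
      ((ContinuousLinearMap.toSpanSingleton ℝ (2 * (M : ℂ) * α / (Real.pi : ℂ))).comp
        (Complex.imCLM.comp (ContinuousLinearMap.mul ℝ ℂ (2 * φ' / (1 - φ z ^ 2))))) z := by
    refine (h2.congr_of_eventuallyEq (Eventually.of_forall fun w => ?_)).congr_fderiv ?_
    · simp only [extremalFun_eq_smul, Function.comp_apply, Complex.imCLM_apply, Complex.log_im,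
        ContinuousLinearMap.toSpanSingleton_apply]
    · refine ContinuousLinearMap.ext fun ξ => ?_
      simp only [ContinuousLinearMap.comp_apply, ContinuousLinearMap.mul_apply',
        ContinuousLinearMap.coe_restrictScalars', ContinuousLinearMap.toSpanSingleton_apply,
        smul_eq_mul, mul_comm]
  rw [h3.fderiv, norm_toSpanSingleton_comp_im_comp_mul]
  simp [hα, abs_of_pos hM, abs_of_pos Real.pi_pos]

/-! ### The extremal function for φ = c · Möbius map -/

section Model

variable {a c : ℂ}

lemma norm_mul_discMoebius_lt_one (ha : ‖a‖ < 1) (hc : ‖c‖ = 1) {z : ℂ} (hz : ‖z‖ < 1) :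
    ‖c * discMoebius a z‖ < 1 := by
  rw [norm_mul, hc, one_mul]; exact norm_discMoebius_lt_one ha hz

lemma harmonicAt_arg_model (ha : ‖a‖ < 1) (hc : ‖c‖ = 1) {z : ℂ} (hz : ‖z‖ < 1) :
    InnerProductSpace.HarmonicAt (fun z => Complex.arg
      ((1 + c * discMoebius a z) / (1 - c * discMoebius a z))) z := by
  have hd : DifferentiableOn ℂ (fun z => Complex.log
      ((1 + c * discMoebius a z) / (1 - c * discMoebius a z))) (ball 0 1) := fun w hw => by
    have hw' := mem_ball_zero_iff.1 hw
    exact (hasDerivAt_log_one_add_div_one_sub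
      ((hasDerivAt_discMoebius (one_add_conj_mul_ne_zero ha hw'.le)).const_mul c)
      (norm_mul_discMoebius_lt_one ha hc hw')).differentiableAt.differentiableWithinAt
  have := (hd.analyticAt (isOpen_ball.mem_nhds (mem_ball_zero_iff.2 hz))).harmonicAt_im
  simpa only [Complex.log_im] using this

lemma harmonicAt_extremalFun_model (M : ℝ) (α : ℂ) (ha : ‖a‖ < 1) (hc : ‖c‖ = 1) {z : ℂ}
    (hz : ‖z‖ < 1) :
    InnerProductSpace.HarmonicAt (extremalFun M α fun w => c * discMoebius a w) z := by
  have := (harmonicAt_arg_model ha hc hz).comp_CLM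
    (ContinuousLinearMap.toSpanSingleton ℝ (2 * (M : ℂ) * α / (Real.pi : ℂ)))
  refine (InnerProductSpace.harmonicAt_congr_nhds (Eventually.of_forall fun w => ?_)).1 this
  simp [extremalFun_eq_smul]

lemma measurable_extremalFun_model (M : ℝ) (α : ℂ) :
    Measurable (extremalFun M α fun w => c * discMoebius a w) := by
  have h1 : Measurable (discMoebius a) := by unfold discMoebius; fun_prop
  unfold extremalFun
  have h2 : Measurable fun z => Complex.arg
      ((1 + c * discMoebius a z) / (1 - c * discMoebius a z)) :=
    Complex.measurable_arg.comp (by fun_prop)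
  fun_prop

lemma norm_extremalFun_le {M : ℝ} (hM : 0 < M) {α : ℂ} (hα : ‖α‖ = 1) (φ : ℂ → ℂ) (z : ℂ) :
    ‖extremalFun M α φ z‖ ≤ 2 * M := by
  rw [norm_extremalFun hM hα]
  calc _ ≤ 2 * M / Real.pi * Real.pi := by gcongr; exact Complex.abs_arg_le_pi _
    _ = 2 * M := by field_simp

open MeasureTheory in
lemma circleIntegrable_extremalFun_model {M : ℝ} (hM : 0 < M) {α : ℂ} (hα : ‖α‖ = 1) :
    CircleIntegrable (extremalFun M α fun w => c * discMoebius a w) 0 1 := by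
  refine (intervalIntegrable_const (c := 2 * M)).mono_fun
    ((measurable_extremalFun_model M α).comp
      (continuous_circleMap 0 1).measurable).aestronglyMeasurable
    (Eventually.of_forall fun t => ?_)
  rw [Real.norm_eq_abs, abs_of_pos (by positivity : 0 < 2 * M)]
  exact norm_extremalFun_le hM hα _ _

/-- Away from φ = ±1, the quotient (1 + φ)/(1 - φ) is a nonzero imaginary number on the circle,
where the argument is continuous. Only two boundary points are lost, so radial limits hold almost
everywhere. -/
lemma continuousAt_extremalFun_model (M : ℝ) (α : ℂ) (ha : ‖a‖ < 1) (hc : ‖c‖ = 1) {η : ℂ}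
    (hη : ‖η‖ = 1) (h1 : c * discMoebius a η ≠ 1) (h2 : c * discMoebius a η ≠ -1) :
    ContinuousAt (extremalFun M α fun w => c * discMoebius a w) η := by
  have hw : ‖c * discMoebius a η‖ = 1 := by
    rw [norm_mul, hc, one_mul, norm_discMoebius_eq_one ha hη]
  have hφ : ContinuousAt (fun w => c * discMoebius a w) η :=
    ((hasDerivAt_discMoebius (one_add_conj_mul_ne_zero ha hη.le)).const_mul c).continuousAt
  have hq : ContinuousAt (fun w => (1 + c * discMoebius a w) / (1 - c * discMoebius a w)) η :=
    (continuousAt_const.add hφ).div (continuousAt_const.sub hφ) (sub_ne_zero.2 h1.symm)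
  have harg := ContinuousAt.comp (g := Complex.arg)
    (f := fun w => (1 + c * discMoebius a w) / (1 - c * discMoebius a w))
    (Complex.continuousAt_arg (one_add_div_one_sub_mem_slitPlane hw h1 h2)) hq
  exact continuousAt_const.mul (ContinuousAt.comp (g := ((↑) : ℝ → ℂ))
    Complex.continuous_ofReal.continuousAt harg)

open MeasureTheory in
lemma tendsto_boundary_extremalFun_model {M : ℝ} (hM : 0 < M) {α : ℂ} (hα : ‖α‖ = 1)
    (ha : ‖a‖ < 1) (hc : ‖c‖ = 1) :
    Tendsto (fun r : ℝ => ∫ t in (0 : ℝ)..(2 * Real.pi),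
      ‖extremalFun M α (fun w => c * discMoebius a w) (circleMap 0 r t)
        - extremalFun M α (fun w => c * discMoebius a w) (circleMap 0 1 t)‖) (𝓝[<] 1) (𝓝 0) := by
  set f := extremalFun M α fun w => c * discMoebius a w with hf
  have hm : Measurable f := measurable_extremalFun_model M α
  have hc0 : c ≠ 0 := fun h => by simp [h] at hc
  have hcount : {t : ℝ | circleMap 0 1 t ∈
      ({discMoebius (-a) (1 / c), discMoebius (-a) (-1 / c)} : Set ℂ)}.Countable :=
    (Set.toFinite _).countable.preimage_circleMap 0 one_ne_zero
  have hexc : ∀ t : ℝ, ∀ u : ℂ, c * discMoebius a (circleMap 0 1 t) = u →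
      circleMap 0 1 t = discMoebius (-a) (u / c) := by
    intro t u hu
    have : discMoebius a (circleMap 0 1 t) = u / c := by rw [← hu]; field_simp
    rw [← this, discMoebius_neg_discMoebius_of_norm_le ha (by simp)]
  have key := intervalIntegral.tendsto_integral_filter_of_dominated_convergence
    (a := 0) (b := 2 * Real.pi) (μ := volume) (l := 𝓝[<] (1 : ℝ))
    (F := fun r t => ‖f (circleMap 0 r t) - f (circleMap 0 1 t)‖) (f := fun _ => (0 : ℝ))
    (fun _ => 2 * M + 2 * M) ?_ ?_ intervalIntegrable_const ?_
  · simpa using key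
  · refine Eventually.of_forall fun r => ?_
    exact (((hm.comp (continuous_circleMap 0 r).measurable).sub
      (hm.comp (continuous_circleMap 0 1).measurable)).norm).aestronglyMeasurable
  · refine Eventually.of_forall fun r => Eventually.of_forall fun t _ => ?_
    rw [norm_norm]
    exact (norm_sub_le _ _).trans (add_le_add (norm_extremalFun_le hM hα _ _)
      (norm_extremalFun_le hM hα _ _))
  · filter_upwards [hcount.ae_notMem volume] with t ht _
    have h1 : c * discMoebius a (circleMap 0 1 t) ≠ 1 := fun h => ht (Or.inl (hexc t 1 h))
    have h2 : c * discMoebius a (circleMap 0 1 t) ≠ -1 := fun h => ht (Or.inr (hexc t (-1) h))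
    have hcont := continuousAt_extremalFun_model M α ha hc (by simp) h1 h2
    have hr : Tendsto (fun r : ℝ => circleMap 0 r t) (𝓝[<] 1) (𝓝 (circleMap 0 1 t)) := by
      have : Continuous fun r : ℝ => circleMap 0 r t := by unfold circleMap; fun_prop
      exact this.continuousAt.tendsto.mono_left nhdsWithin_le_nhds
    rw [← hf] at hcont
    simpa using ((hcont.tendsto.comp hr).sub_const (f (circleMap 0 1 t))).norm

lemma poissonKernel_ofReal_mul {R : ℝ} (hR : R ≠ 0) (w η : ℂ) :
    poissonKernel 0 (R * w) (R * η) = poissonKernel 0 w η := by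
  simp only [poissonKernel_def, sub_zero, ← mul_sub, norm_mul, mul_pow]
  rw [mul_div_mul_left]
  simpa using hR

/-- On the circle of radius R < 1 the Poisson formula is exact at Rw, with the same kernel as at w
on the unit circle. Letting R → 1 uses the L¹ boundary convergence. -/
lemma poissonIntegral_extremalFun_model {M : ℝ} (hM : 0 < M) {α : ℂ} (hα : ‖α‖ = 1)
    (ha : ‖a‖ < 1) (hc : ‖c‖ = 1) {w : ℂ} (hw : ‖w‖ < 1) :
    poissonIntegral (extremalFun M α fun w => c * discMoebius a w) w
      = extremalFun M α (fun w => c * discMoebius a w) w := by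
  set f := extremalFun M α fun w => c * discMoebius a w with hf
  set κ : ℂ := 2 * (M : ℂ) * α / (Real.pi : ℂ)
  set v : ℂ → ℝ := fun z => Complex.arg ((1 + c * discMoebius a z) / (1 - c * discMoebius a z))
  have hfv : ∀ z, f z = v z • κ := fun z => extremalFun_eq_smul M α _ z
  have hcf : ContinuousOn f (ball 0 1) := fun z hz =>
    (harmonicAt_extremalFun_model M α ha hc
      (mem_ball_zero_iff.1 hz)).1.continuousAt.continuousWithinAt
  have hlim := tendsto_integral_smul_circleMap hcf (circleIntegrable_extremalFun_model hM hα)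
    (tendsto_boundary_extremalFun_model hM hα ha hc) (continuous_poissonKernel_circleMap hw)
  have hlim2 : Tendsto (fun R : ℝ => (2 * Real.pi) • f (R * w)) (𝓝[<] 1)
      (𝓝 ((2 * Real.pi) • f w)) := by
    have h1 : ContinuousAt f w := hcf.continuousAt (isOpen_ball.mem_nhds (by simpa using hw))
    have h2 : Tendsto (fun R : ℝ => (R : ℂ) * w) (𝓝[<] 1) (𝓝 w) :=
      (Continuous.tendsto' (by fun_prop) (1 : ℝ) w (by simp)).mono_left nhdsWithin_le_nhds
    exact (h1.tendsto.comp h2).const_smul _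
  have heq : ∀ᶠ R : ℝ in 𝓝[<] 1, (2 * Real.pi) • f (R * w)
      = ∫ t in (0 : ℝ)..2 * Real.pi, poissonKernel 0 w (circleMap 0 1 t) • f (circleMap 0 R t) := by
    filter_upwards [Ioo_mem_nhdsLT (zero_lt_one (α := ℝ))] with R hR
    have hh : InnerProductSpace.HarmonicOnNhd v (closedBall 0 R) := fun z hz =>
      harmonicAt_arg_model ha hc ((mem_closedBall_zero_iff.1 hz).trans_lt hR.2)
    have hRw : (R : ℂ) * w ∈ ball (0 : ℂ) R := by
      rw [mem_ball_zero_iff, norm_mul, Complex.norm_real, Real.norm_eq_abs, abs_of_pos hR.1]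
      nlinarith [hR.1]
    have := InnerProductSpace.HarmonicOnNhd.circleAverage_poissonKernel_smul hh hRw
    rw [Real.circleAverage_def, smul_eq_mul, inv_mul_eq_iff_eq_mul₀ (by positivity)] at this
    rw [hfv, smul_smul, ← this, ← intervalIntegral.integral_smul_const]
    refine intervalIntegral.integral_congr fun t _ => ?_
    have e : circleMap 0 R t = R * circleMap 0 1 t := by simp [circleMap]
    simp only [hfv, smul_smul, Pi.smul_apply', smul_eq_mul]
    rw [e, poissonKernel_ofReal_mul hR.1.ne']
  have hu := tendsto_nhds_unique hlim (hlim2.congr' heq)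
  rw [poissonIntegral, Real.circleAverage_def, hu, smul_smul, inv_mul_cancel₀ (by positivity),
    one_smul]

lemma discSup_poissonIntegral_extremalFun_model {M : ℝ} (hM : 0 < M) {α : ℂ} (hα : ‖α‖ = 1)
    (ha : ‖a‖ < 1) (hc : ‖c‖ = 1) :
    discSup (poissonIntegral (extremalFun M α fun w => c * discMoebius a w))
      = ENNReal.ofReal M := by
  have hc0 : c ≠ 0 := fun h => by simp [h] at hc
  have hnorm : ∀ w ∈ ball (0 : ℂ) 1,
      ‖poissonIntegral (extremalFun M α fun w => c * discMoebius a w) w‖ₑ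
      = ENNReal.ofReal (2 * M / Real.pi *
        |Complex.arg ((1 + c * discMoebius a w) / (1 - c * discMoebius a w))|) := by
    intro w hw
    rw [poissonIntegral_extremalFun_model hM hα ha hc (mem_ball_zero_iff.1 hw), ← ofReal_norm,
      norm_extremalFun hM hα]
  have hval : 2 * M / Real.pi * (Real.pi / 2) = M := by
    field_simp
  refine le_antisymm (iSup₂_le fun w hw => ?_) ?_
  · rw [hnorm w hw]
    refine ENNReal.ofReal_le_ofReal ?_
    rw [← hval]
    gcongr
    rw [hval]
    exact (abs_arg_one_add_div_one_sub_lt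
      (norm_mul_discMoebius_lt_one ha hc (mem_ball_zero_iff.1 hw))).le
  -- The supremum is approached along the points where φ = s·I with s → 1⁻, since the argument tends
  -- to that of I, namely π/2.
  · have hI : (1 + Complex.I) / (1 - Complex.I) = Complex.I := by
      have : 1 - Complex.I ≠ 0 := fun h => by simpa using congrArg Complex.im h
      rw [div_eq_iff this]
      linear_combination Complex.I_mul_I
    have hcont : ContinuousAt (fun s : ℝ => 2 * M / Real.pi *
        |Complex.arg ((1 + s * Complex.I) / (1 - s * Complex.I))|) 1 := by
      have hq : ContinuousAt (fun s : ℝ => (1 + s * Complex.I) / (1 - s * Complex.I)) 1 := by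
        refine ContinuousAt.div (by fun_prop) (by fun_prop) fun h => ?_
        simpa using congrArg Complex.im h
      have harg : ContinuousAt Complex.arg
          ((1 + ((1 : ℝ) : ℂ) * Complex.I) / (1 - ((1 : ℝ) : ℂ) * Complex.I)) :=
        Complex.continuousAt_arg (by
          rw [Complex.ofReal_one, one_mul, hI]; exact Or.inr (by simp))
      exact continuousAt_const.mul (ContinuousAt.abs
        (ContinuousAt.comp (g := Complex.arg) harg hq))
    have hl := ENNReal.tendsto_ofReal (hcont.tendsto.mono_left (nhdsWithin_le_nhds (s := Iio 1)))
    rw [Complex.ofReal_one, one_mul, hI, Complex.arg_I, abs_of_pos (by positivity), hval] at hl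
    refine le_of_tendsto hl ?_
    filter_upwards [Ioo_mem_nhdsLT (zero_lt_one (α := ℝ))] with s hs
    have hsn : ‖(s : ℂ) * Complex.I / c‖ < 1 := by
      simpa [hc, abs_of_pos hs.1] using hs.2
    have hwm : discMoebius (-a) (s * Complex.I / c) ∈ ball (0 : ℂ) 1 :=
      mem_ball_zero_iff.2 (norm_discMoebius_lt_one (by simpa using ha) hsn)
    have e : c * discMoebius a (discMoebius (-a) (s * Complex.I / c)) = s * Complex.I := by
      rw [discMoebius_discMoebius_neg_of_norm_le ha hsn.le]; field_simp
    have := hnorm _ hwm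
    rw [e] at this
    rw [← this]
    exact le_iSup₂ (f := fun z (_ : z ∈ ball (0 : ℂ) 1) =>
      ‖poissonIntegral (extremalFun M α fun w => c * discMoebius a w) z‖ₑ) _ hwm

lemma norm_fderiv_extremalFun_model {M : ℝ} (hM : 0 < M) {α : ℂ} (hα : ‖α‖ = 1)
    (ha : ‖a‖ < 1) (hc : ‖c‖ = 1) {z : ℂ} (hz : ‖z‖ < 1)
    (hreal : (c * discMoebius a z).im = 0) :
    ‖fderiv ℝ (extremalFun M α fun w => c * discMoebius a w) z‖
      = 4 / Real.pi * (1 / (1 - ‖z‖ ^ 2)) * M := by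
  have hne := one_add_conj_mul_ne_zero ha hz.le
  have hpa := one_sub_sq_norm_pos ha
  have hpz := one_sub_sq_norm_pos hz
  have hlt := norm_mul_discMoebius_lt_one ha hc hz
  have hd := (hasDerivAt_discMoebius hne).const_mul c
  rw [norm_fderiv_extremalFun hM hα hd hlt]
  have hn : 0 < ‖1 + conj a * z‖ := norm_pos_iff.2 hne
  -- This is where φ(z) real matters: |1 - φ²| = 1 - |φ|², and equality in Schwarz–Pick does the
  -- rest.
  have hden : ‖1 - (c * discMoebius a z) ^ 2‖
      = (1 - ‖a‖ ^ 2) * (1 - ‖z‖ ^ 2) / ‖1 + conj a * z‖ ^ 2 := by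
    rw [← one_sub_sq_norm_discMoebius hne]
    have hre : c * discMoebius a z = (((c * discMoebius a z).re : ℝ) : ℂ) :=
      Complex.ext (by simp) (by simpa using hreal)
    have hsq : ‖discMoebius a z‖ ^ 2 = (c * discMoebius a z).re ^ 2 := by
      have : ‖discMoebius a z‖ = ‖c * discMoebius a z‖ := by rw [norm_mul, hc, one_mul]
      rw [this]; nth_rw 1 [hre]
      rw [Complex.norm_real, Real.norm_eq_abs, sq_abs]
    have hpos : 0 ≤ 1 - ‖discMoebius a z‖ ^ 2 :=
      (one_sub_sq_norm_pos (norm_discMoebius_lt_one ha hz)).le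
    rw [hsq] at hpos ⊢
    nth_rw 1 [hre]
    rw [← abs_of_nonneg hpos, ← Real.norm_eq_abs, ← Complex.norm_real]
    push_cast
    rfl
  rw [norm_div, hden, norm_mul, norm_mul, hc, norm_div, norm_pow, Complex.norm_real,
    Real.norm_eq_abs, abs_of_pos hpa, Complex.norm_two]
  field_simp
  norm_num

end Model

/-- The boundary function is built from the Möbius form rather than from φ, whose values outside the
open disc are arbitrary. -/
theorem isPoissonSolution_extremalFun {M : ℝ} (hM : 0 < M) {α : ℂ} (hα : ‖α‖ = 1) {a c : ℂ}
    (ha : ‖a‖ < 1) (hc : ‖c‖ = 1) {φ : ℂ → ℂ}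
    (hφ : EqOn φ (fun w => c * discMoebius a w) (ball 0 1)) :
    IsPoissonSolution (extremalFun M α φ) (fun _ => 0)
      (extremalFun M α fun w => c * discMoebius a w) := by
  have heq := extremalFun_congr (M := M) (α := α) hφ
  have hharm : ∀ z ∈ ball (0 : ℂ) 1, InnerProductSpace.HarmonicAt (extremalFun M α φ) z :=
    fun z hz => (InnerProductSpace.harmonicAt_congr_nhds
      (heq.eventuallyEq_of_mem (isOpen_ball.mem_nhds hz))).2
      (harmonicAt_extremalFun_model M α ha hc (mem_ball_zero_iff.1 hz))
  refine ⟨continuousOn_const, fun z hz => (hharm z hz).1.contDiffWithinAt,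
    fun z hz => (hharm z hz).2.self_of_nhds, circleIntegrable_extremalFun_model hM hα, ?_⟩
  refine (tendsto_boundary_extremalFun_model hM hα ha hc).congr' ?_
  filter_upwards [Ioo_mem_nhdsLT (zero_lt_one (α := ℝ))] with R hR
  refine intervalIntegral.integral_congr fun t _ => ?_
  simp only [heq (circleMap_mem_ball hR.1 hR.2 t)]

theorem enorm_fderiv_extremalFun {M : ℝ} (hM : 0 < M) {α : ℂ} (hα : ‖α‖ = 1) {a c : ℂ}
    (ha : ‖a‖ < 1) (hc : ‖c‖ = 1) {φ : ℂ → ℂ}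
    (hφ : EqOn φ (fun w => c * discMoebius a w) (ball 0 1)) {z : ℂ} (hz : z ∈ ball (0 : ℂ) 1)
    (hreal : (φ z).im = 0) :
    ‖fderiv ℝ (extremalFun M α φ) z‖ₑ
      = ENNReal.ofReal (4 / Real.pi * (1 / (1 - ‖z‖ ^ 2))) * ENNReal.ofReal M := by
  have hz' := mem_ball_zero_iff.1 hz
  have hp := one_sub_sq_norm_pos hz'
  have heq := extremalFun_congr (M := M) (α := α) hφ
  rw [(heq.eventuallyEq_of_mem (isOpen_ball.mem_nhds hz)).fderiv_eq, ← ofReal_norm,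
    norm_fderiv_extremalFun_model hM hα ha hc hz' (by rw [← hreal, hφ hz]),
    ENNReal.ofReal_mul (by positivity)]

end Sharpness

/-! ### The theorem -/

theorem theorem1p3 :
    (∀ f g ψ : ℂ → ℂ, IsPoissonSolution f g ψ →
      discSup g ≠ ∞ ∧
      (∀ z ∈ ball (0 : ℂ) 1, z ≠ 0 →
        ‖fderiv ℝ f z‖ₑ ≤ gradBound (discSup (poissonIntegral ψ)) (discSup g).toReal ‖z‖) ∧
      (∀ r ∈ Ioo (0 : ℝ) 1,
        (discSup g).toReal / 4 ≤ muFun (discSup g).toReal r ∧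
          muFun (discSup g).toReal r ≤ (discSup g).toReal / 3) ∧
      AntitoneOn (muFun (discSup g).toReal) (Ioo 0 1) ∧
      (0 < (discSup g).toReal → StrictAntiOn (muFun (discSup g).toReal) (Ioo 0 1)) ∧
      Tendsto (fun z : ℂ => gradBound (discSup (poissonIntegral ψ)) (discSup g).toReal ‖z‖)
        (𝓝[≠] 0) (𝓝 (gradBoundZero (discSup (poissonIntegral ψ)) (discSup g).toReal)) ∧
      ‖fderiv ℝ f 0‖ₑ ≤ gradBoundZero (discSup (poissonIntegral ψ)) (discSup g).toReal) ∧
    (∀ (M : ℝ) (α : ℂ), 0 < M → ‖α‖ = 1 →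
      (∀ φ : ℂ → ℂ, IsDiscAutomorphism φ →
        ∃ ψ : ℂ → ℂ, IsPoissonSolution (extremalFun M α φ) (fun _ => 0) ψ ∧
          discSup (poissonIntegral ψ) = ENNReal.ofReal M ∧
          (∀ z ∈ ball (0 : ℂ) 1, z ≠ 0 → (φ z).im = 0 →
            ‖fderiv ℝ (extremalFun M α φ) z‖ₑ = gradBound (discSup (poissonIntegral ψ)) 0 ‖z‖) ∧
          ((φ 0).im = 0 →
            ‖fderiv ℝ (extremalFun M α φ) 0‖ₑ =
              gradBoundZero (discSup (poissonIntegral ψ)) 0)) ∧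
      (∀ z ∈ ball (0 : ℂ) 1, ∃ φ : ℂ → ℂ, IsDiscAutomorphism φ ∧ φ z = 0)) := by
  refine ⟨fun f g ψ h => ?_, fun M α hM hα => ⟨fun φ hφ => ?_, fun z hz => ?_⟩⟩
  · set N := (discSup g).toReal with hN
    have hN0 : 0 ≤ N := ENNReal.toReal_nonneg
    refine ⟨discSup_ne_top_of_continuousOn h.continuousOn_rhs,
      fun z hz hz0 => enorm_fderiv_le_gradBound h hz hz0, fun r hr => ?_, fun r hr s hs hrs => ?_,
      fun hpos r hr s hs hrs => ?_, tendsto_gradBound _ _, enorm_fderiv_zero_le_gradBoundZero h⟩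
    · rw [muFun_eq_mul, div_eq_mul_one_div, div_eq_mul_one_div N 3]
      have := le_muFun_one hr
      exact ⟨mul_le_mul_of_nonneg_left (by nlinarith [hr.1, hr.2]) hN0,
        mul_le_mul_of_nonneg_left (muFun_one_le hr) hN0⟩
    · rw [muFun_eq_mul, muFun_eq_mul N r]
      exact mul_le_mul_of_nonneg_left (strictAntiOn_muFun_one.antitoneOn hr hs hrs) hN0
    · rw [muFun_eq_mul, muFun_eq_mul N r]
      exact mul_lt_mul_of_pos_left (strictAntiOn_muFun_one hr hs hrs) hpos
  · obtain ⟨a, c, ha, hc, heq⟩ := hφ.exists_eqOn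
    have hsup := discSup_poissonIntegral_extremalFun_model hM hα ha hc
    refine ⟨_, isPoissonSolution_extremalFun hM hα ha hc heq, hsup, fun z hz _ him => ?_,
      fun him => ?_⟩
    · rw [enorm_fderiv_extremalFun hM hα ha hc heq hz him, hsup, gradBound, muFun_eq_mul]
      simp
    · rw [enorm_fderiv_extremalFun hM hα ha hc heq (by simp) him, hsup, gradBoundZero]
      simp
  · have hz' : ‖-z‖ < 1 := by simpa using hz
    exact ⟨discMoebius (-z), isDiscAutomorphism_discMoebius hz', by simp [discMoebius]⟩
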